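/- Let $G=(V,E)$ be a finite connected simple graph and let $\gamma:(0,\infty)\to(0,\infty)$ be Lipschitz on $[\delta,M]$ for all $0<\delta<M$. For edge weights $w$ on a graph on $V$, let $d(x,y)$ be the least total weight of a path from $x$ to $y$. For $\alpha\in[0,1]$ let $\mu_x^\alpha$ be the distribution with $\mu_x^\alpha(x)=\alpha$, $\mu_x^\alpha(y)=(1-\alpha)\gamma(w_{xy})/\sum_{z\sim x}\gamma(w_{xz})$ for $y\sim x$, and $\mu_x^\alpha(y)=0$ otherwise. Let $W$ be the transportation distance with cost $d$, let $\kappa_\alpha(x,y)=1-W(\mu_x^\alpha,\mu_y^\alpha)/d(x,y)$, and let $\kappa(x,y)=\lim_{\alpha\to1^-}\kappa_\alpha(x,y)/(1-\alpha)$ be the Ollivier–Lin–Lu–Yau curvature. The unnormalized Ricci flow is the system $$\frac{dw_e}{dt}=-\kappa_e w_e\qquad(e\in E),$$ where $\kappa_e=\kappa(x,y)$ for $e=xy$; the existence of the limits $\kappa_e$ is part of being a solution, and solutions take values in $[0,\infty)^E$. The exit condition (I) is: $w_{uv}(t)>d(u,v)(t)$ for some edge $uv$ and some time $t$. The flow with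 exit condition (I) starts at time $0$ on $G$ with given weights and runs as follows. If the solution on the current graph never meets (I), it is followed for all later times. Otherwise let $T$ be the infimum of the times at which the solution on the current graph (continued slightly beyond $T$) meets (I), and let $S$ be the nonempty set of edges $uv$ for which $T$ is the infimum of the times with $w_{uv}>d(u,v)$. The solution is followed on $[\,\cdot\,,T)$; at time $T$ a nonempty subset of $S$, chosen by a fixed rule from $S$ (for example all of $S$, or one edge of it), is deleted, and the flow is restarted at time $T$ on the remaining graph from the current weights of the remaining edges. Then, for every choice of initial weights $w_e(0)>0$, $e\in E$: 1. For every selection rule, the flow with exit condition (I) has exactly one solution, and it is defined for all $t\in[0,\infty)$: there are graphs $G(t)$ and weights $w(t)$ on the edges of $G(t)$, $t\ge 0$, with finitely many deletions, that follow the flow, and they are unique. All weights $w_e(t)$ of edges of $G(t)$ are positive. 2. In particular, if no solution on $G$ with these initial weights on any interval $[0,b)$, $b>0$, meets (I), so that each edge is always a shortest path between its ends, then the system $dw_e/dt=-\kappa_e w_e$ on $G$ has exactly one solution on $[0,\infty)$ with these initial weights, and its weights are positive for all time. -/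

import Mathlib

open Set Filter Topology

namespace RicciFlow

noncomputable section

variable {V : Type*} [Fintype V]

/-- The weighted distance `d(x, y)`: the least total weight of a path of `H` from `x` to `y`.
A weight function is a function on unordered pairs; only its values on edges of `H` matter. -/
def wdist (H : SimpleGraph V) (w : Sym2 V → ℝ) (x y : V) : ℝ :=
  ⨅ p : H.Path x y, (p.1.edges.map w).sum

open Classical in
/-- The lazy random walk distribution `μ_x^α`. -/
def lazyWalk (γ : ℝ → ℝ) (H : SimpleGraph V) (w : Sym2 V → ℝ) (α : ℝ) (x y : V) : ℝ :=
  if y = x then α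
  else if H.Adj x y then
    (1 - α) * (γ (w s(x, y)) / ∑ z with H.Adj x z, γ (w s(x, z)))
  else 0

/-- `A` is a coupling of the distributions `μ₁` and `μ₂`. -/
def IsCoupling (μ₁ μ₂ : V → ℝ) (A : V → V → ℝ) : Prop :=
  (∀ x y, A x y ∈ Icc (0 : ℝ) 1) ∧ (∀ x, ∑ y, A x y = μ₁ x) ∧ (∀ y, ∑ x, A x y = μ₂ y)

/-- The transportation distance between `μ₁` and `μ₂` with respect to the cost `d`. -/
def transport (d : V → V → ℝ) (μ₁ μ₂ : V → ℝ) : ℝ :=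
  sInf {c : ℝ | ∃ A, IsCoupling μ₁ μ₂ A ∧ c = ∑ x, ∑ y, A x y * d x y}

/-- The `α`-Ricci curvature `κ_α(x, y)`. -/
def alphaCurvature (γ : ℝ → ℝ) (H : SimpleGraph V) (w : Sym2 V → ℝ) (α : ℝ) (x y : V) : ℝ :=
  1 - transport (wdist H w) (lazyWalk γ H w α x) (lazyWalk γ H w α y) / wdist H w x y

/-- The Ollivier-Lin-Lu-Yau curvature `κ(x, y) = lim_{α → 1} κ_α(x, y) / (1 - α)` exists and
equals `k`. -/
def HasRicciCurvature (γ : ℝ → ℝ) (H : SimpleGraph V) (w : Sym2 V → ℝ) (x y : V) (k : ℝ) :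
    Prop :=
  Tendsto (fun α : ℝ => alphaCurvature γ H w α x y / (1 - α)) (𝓝[<] 1) (𝓝 k)

/-- `X` solves the unnormalized Ricci flow `dw_e/dt = -κ_e w_e` on the graph `H` over the time
interval `I`: the weights are nonnegative and, for every edge, the curvature exists and the
equation holds (with a one-sided derivative at an end point of `I`). -/
def IsSolutionOn (γ : ℝ → ℝ) (H : SimpleGraph V) (X : ℝ → Sym2 V → ℝ) (I : Set ℝ) : Prop :=
  ∀ t ∈ I, (∀ e ∈ H.edgeSet, 0 ≤ X t e) ∧
    ∀ x y, H.Adj x y → ∃ k, HasRicciCurvature γ H (X t) x y k ∧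
      HasDerivWithinAt (fun τ => X τ s(x, y)) (-k * X t s(x, y)) I t

/-- The edges `uv` of `H` with `w_{uv} > d(u, v)`. The exit condition is met when there is one. -/
def exceedingEdges (H : SimpleGraph V) (w : Sym2 V → ℝ) : Set (Sym2 V) :=
  {e | ∃ u v, H.Adj u v ∧ e = s(u, v) ∧ wdist H w u v < w s(u, v)}

/-- The edges of `H` that start to exceed the distance between their ends at the time `T`, when
`X` is followed over the time interval `I`. -/
def exitingEdges (H : SimpleGraph V) (X : ℝ → Sym2 V → ℝ) (I : Set ℝ) (T : ℝ) : Set (Sym2 V) :=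
  {e | IsGLB {t ∈ I | e ∈ exceedingEdges H (X t)} T}

/-- `sel` picks at least one edge out of every nonempty set of edges. -/
def IsSelectionRule (sel : Set (Sym2 V) → Set (Sym2 V)) : Prop :=
  ∀ S : Set (Sym2 V), S.Nonempty → (sel S).Nonempty ∧ sel S ⊆ S

/-- `IsFlow γ sel H s w₀ K Y`: on the time interval `[s, ∞)`, the graphs `K t` with the weights
`Y t` follow the unnormalized Ricci flow with the exit condition, started at time `s` from the
graph `H` with the weights `w₀`.

Either the exit condition is never met, and `Y` is a solution on `H` for all times `t ≥ s`; or the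
solution `X` on `H` meets it, first at time `T`: then the flow is `X` before `T`, the edges that
`sel` picks among those exiting at `T` are deleted, and the flow is restarted at time `T` from the
remaining graph with its current weights. -/
inductive IsFlow (γ : ℝ → ℝ) (sel : Set (Sym2 V) → Set (Sym2 V)) :
    SimpleGraph V → ℝ → (Sym2 V → ℝ) → (ℝ → SimpleGraph V) → (ℝ → Sym2 V → ℝ) → Prop
  | noExit {H : SimpleGraph V} {s : ℝ} {w₀ : Sym2 V → ℝ}
      {K : ℝ → SimpleGraph V} {Y : ℝ → Sym2 V → ℝ}
      (hY : IsSolutionOn γ H Y (Ici s))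
      (hinit : ∀ e ∈ H.edgeSet, Y s e = w₀ e)
      (hno : ∀ t, s ≤ t → exceedingEdges H (Y t) = ∅)
      (hK : ∀ t, s ≤ t → K t = H) :
      IsFlow γ sel H s w₀ K Y
  | exit {H : SimpleGraph V} {s : ℝ} {w₀ : Sym2 V → ℝ}
      {K : ℝ → SimpleGraph V} {Y : ℝ → Sym2 V → ℝ}
      (X : ℝ → Sym2 V → ℝ) (b T : ℝ)
      (hX : IsSolutionOn γ H X (Ico s b))
      (hinit : ∀ e ∈ H.edgeSet, X s e = w₀ e)
      (hT : IsGLB {t ∈ Ico s b | (exceedingEdges H (X t)).Nonempty} T)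
      (hK : ∀ t ∈ Ico s T, K t = H)
      (hYX : ∀ t ∈ Ico s T, ∀ e ∈ H.edgeSet, Y t e = X t e)
      (hrest : IsFlow γ sel (H.deleteEdges (sel (exitingEdges H X (Ico s b) T))) T (X T) K Y) :
      IsFlow γ sel H s w₀ K Y

end

end RicciFlow

/-! For positive weights the flow is an ordinary differential equation with a locally Lipschitz
right-hand side. Along an edge `xy` the transportation distance between the lazy walks is affine in
`α` on `[1/2, 1)` and tends to `d(x, y)` as `α → 1` (`transport_lazy`). Hence `κ` exists and equals
`2κ_{1/2}`, and the equation becomes `w_e' = -2 w_e + 2 W w_e / d(x, y)`, with `W` the distance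
between the half-lazy walks (`hasRicciCurvature_iff`, `field_eq`). Both `W` and `d` are Lipschitz in
the weights while these stay in a compact interval of positive numbers
(`exists_lipschitzOnWith_field`), so solutions are unique.

It remains to exclude collapse and blow-up. Since `W ≥ 0`, `w_e' ≥ -2 w_e`: weights decay at most
exponentially and stay positive. As long as (I) is not met, `d(x, y) = w_e` cancels and `w_e' ≤ 2 W
≤ 2 |V| max w`: weights grow at most exponentially. So up to any finite time a solution that has not
met (I) lies strictly inside a fixed box, and by continuity it can be followed a little beyond the
exit time (`exists_solution`).

Every exit deletes at least one edge of a finite graph, so induction on the number of edges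
constructs the whole flow (`exists_isFlow`). For uniqueness, two solutions agree on their common
interval, hence have the same exit time and the same exiting edges (`IsFlow.unique`). -/

namespace RicciFlow

/-! ### Couplings and transportation distance -/

section Transport

variable {V : Type*} [Fintype V]

/-- Nonnegative functions with total mass one. -/
def IsDistribution (μ : V → ℝ) : Prop := (∀ x, 0 ≤ μ x) ∧ ∑ x, μ x = 1

lemma isCoupling_of_nonneg {μ ν : V → ℝ} {A : V → V → ℝ} (hμ : IsDistribution μ)
    (h0 : ∀ x y, 0 ≤ A x y) (h1 : ∀ x, ∑ y, A x y = μ x) (h2 : ∀ y, ∑ x, A x y = ν y) :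
    IsCoupling μ ν A := by
  refine ⟨fun x y => ⟨h0 x y, ?_⟩, h1, h2⟩
  calc A x y ≤ ∑ y, A x y := Finset.single_le_sum (fun z _ => h0 x z) (Finset.mem_univ y)
    _ = μ x := h1 x
    _ ≤ ∑ x, μ x := Finset.single_le_sum (fun z _ => hμ.1 z) (Finset.mem_univ x)
    _ = 1 := hμ.2

lemma isCoupling_prod {μ ν : V → ℝ} (hμ : IsDistribution μ) (hν : IsDistribution ν) :
    IsCoupling μ ν (fun x y => μ x * ν y) := by
  refine isCoupling_of_nonneg hμ (fun x y => mul_nonneg (hμ.1 x) (hν.1 y)) (fun x => ?_)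
    (fun y => ?_)
  · rw [← Finset.mul_sum, hν.2, mul_one]
  · rw [← Finset.sum_mul, hμ.2, one_mul]

lemma IsCoupling.sum_eq_one {μ ν : V → ℝ} {A : V → V → ℝ} (hμ : IsDistribution μ)
    (hA : IsCoupling μ ν A) : ∑ x, ∑ y, A x y = 1 := by
  rw [← hμ.2]
  exact Finset.sum_congr rfl fun x _ => hA.2.1 x

lemma IsCoupling.cost_nonneg {d : V → V → ℝ} (hd : ∀ x y, 0 ≤ d x y) {μ ν : V → ℝ}
    {A : V → V → ℝ} (hA : IsCoupling μ ν A) : 0 ≤ ∑ x, ∑ y, A x y * d x y :=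
  Finset.sum_nonneg fun x _ => Finset.sum_nonneg fun y _ => mul_nonneg (hA.1 x y).1 (hd x y)

lemma IsCoupling.cost_le {d : V → V → ℝ} {D : ℝ} (hD : ∀ x y, d x y ≤ D) {μ ν : V → ℝ}
    (hμ : IsDistribution μ) {A : V → V → ℝ} (hA : IsCoupling μ ν A) :
    ∑ x, ∑ y, A x y * d x y ≤ D := by
  calc ∑ x, ∑ y, A x y * d x y ≤ ∑ x, ∑ y, A x y * D :=
        Finset.sum_le_sum fun x _ => Finset.sum_le_sum fun y _ =>
          mul_le_mul_of_nonneg_left (hD x y) (hA.1 x y).1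
    _ = (∑ x, ∑ y, A x y) * D := by simp only [Finset.sum_mul]
    _ = D := by rw [hA.sum_eq_one hμ, one_mul]

lemma transport_nonneg {d : V → V → ℝ} (hd : ∀ x y, 0 ≤ d x y) (μ ν : V → ℝ) :
    0 ≤ transport d μ ν :=
  Real.sInf_nonneg fun _ ⟨_, hA, hc⟩ => hc ▸ hA.cost_nonneg hd

lemma transport_le_cost {d : V → V → ℝ} (hd : ∀ x y, 0 ≤ d x y) {μ ν : V → ℝ} {A : V → V → ℝ}
    (hA : IsCoupling μ ν A) : transport d μ ν ≤ ∑ x, ∑ y, A x y * d x y :=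
  csInf_le ⟨0, fun _ ⟨_, hA, hc⟩ => hc ▸ hA.cost_nonneg hd⟩ ⟨A, hA, rfl⟩

/-- The product coupling shows that the set of costs is nonempty; for an empty set `sInf` would be
the default value `0`. -/
lemma le_transport {d : V → V → ℝ} {μ ν : V → ℝ} (hμ : IsDistribution μ) (hν : IsDistribution ν)
    {c : ℝ} (h : ∀ A, IsCoupling μ ν A → c ≤ ∑ x, ∑ y, A x y * d x y) : c ≤ transport d μ ν :=
  le_csInf ⟨_, _, isCoupling_prod hμ hν, rfl⟩ fun _ ⟨A, hA, hc⟩ => hc ▸ h A hA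

lemma transport_le {d : V → V → ℝ} (hd : ∀ x y, 0 ≤ d x y) {D : ℝ} (hD : ∀ x y, d x y ≤ D)
    {μ ν : V → ℝ} (hμ : IsDistribution μ) (hν : IsDistribution ν) : transport d μ ν ≤ D :=
  (transport_le_cost hd (isCoupling_prod hμ hν)).trans ((isCoupling_prod hμ hν).cost_le hD hμ)

lemma transport_comm_le {d : V → V → ℝ} (hd : ∀ x y, 0 ≤ d x y) (hs : ∀ x y, d x y = d y x)
    {μ ν : V → ℝ} (hμ : IsDistribution μ) (hν : IsDistribution ν) :
    transport d μ ν ≤ transport d ν μ := by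
  refine le_transport hν hμ fun A hA => ?_
  refine (transport_le_cost hd (A := fun x y => A y x)
    ⟨fun x y => hA.1 y x, hA.2.2, hA.2.1⟩).trans_eq ?_
  rw [Finset.sum_comm]
  exact Finset.sum_congr rfl fun x _ => Finset.sum_congr rfl fun y _ => by rw [hs]

lemma transport_comm {d : V → V → ℝ} (hd : ∀ x y, 0 ≤ d x y) (hs : ∀ x y, d x y = d y x)
    {μ ν : V → ℝ} (hμ : IsDistribution μ) (hν : IsDistribution ν) :
    transport d μ ν = transport d ν μ :=
  le_antisymm (transport_comm_le hd hs hμ hν) (transport_comm_le hd hs hν hμ)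

lemma transport_le_add_of_cost_le {d d' : V → V → ℝ} (hd : ∀ x y, 0 ≤ d x y) {η : ℝ}
    (h : ∀ x y, d x y ≤ d' x y + η) {μ ν : V → ℝ} (hμ : IsDistribution μ)
    (hν : IsDistribution ν) : transport d μ ν ≤ transport d' μ ν + η := by
  rw [← sub_le_iff_le_add]
  refine le_transport hμ hν fun A hA => ?_
  rw [sub_le_iff_le_add]
  refine (transport_le_cost hd hA).trans ?_
  calc ∑ x, ∑ y, A x y * d x y ≤ ∑ x, ∑ y, (A x y * d' x y + A x y * η) := by
        refine Finset.sum_le_sum fun x _ => Finset.sum_le_sum fun y _ => ?_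
        rw [← mul_add]
        exact mul_le_mul_of_nonneg_left (h x y) (hA.1 x y).1
    _ = ∑ x, ∑ y, A x y * d' x y + (∑ x, ∑ y, A x y) * η := by
        simp only [Finset.sum_add_distrib, Finset.sum_mul]
    _ = _ := by rw [hA.sum_eq_one hμ, one_mul]

/-- Keep the fraction `1 - ε` of a coupling and redistribute the remaining mass `ε` arbitrarily. -/
lemma transport_le_add_of_le_mul {d : V → V → ℝ} (hd : ∀ x y, 0 ≤ d x y) {D : ℝ}
    (hD : ∀ x y, d x y ≤ D) {μ ν μ' ν' : V → ℝ} (hμ : IsDistribution μ) (hν : IsDistribution ν)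
    (hμ' : IsDistribution μ') (hν' : IsDistribution ν') {ε : ℝ} (hε : 0 ≤ ε)
    (h1 : ∀ x, (1 - ε) * μ x ≤ μ' x) (h2 : ∀ x, (1 - ε) * ν x ≤ ν' x) :
    transport d μ' ν' ≤ transport d μ ν + ε * D := by
  have hV : Nonempty V := by
    by_contra h
    rw [not_nonempty_iff] at h
    have := hμ.2
    simp at this
  obtain ⟨v⟩ := hV
  have hD0 : 0 ≤ D := (hd v v).trans (hD v v)
  rcases le_or_gt 1 ε with h | h
  -- For `ε ≥ 1` the bound is trivial: every transportation distance is at most `D`.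
  · have := transport_le hd hD hμ' hν'
    have := transport_nonneg hd μ ν
    nlinarith
  rw [← sub_le_iff_le_add]
  refine le_transport hμ hν fun A hA => ?_
  rw [sub_le_iff_le_add]
  set R : V → ℝ := fun x => μ' x - (1 - ε) * μ x with hR
  set Q : V → ℝ := fun x => ν' x - (1 - ε) * ν x with hQ
  have hR0 : ∀ x, 0 ≤ R x := fun x => sub_nonneg.2 (h1 x)
  have hQ0 : ∀ x, 0 ≤ Q x := fun x => sub_nonneg.2 (h2 x)
  have hRs : ∑ x, R x = ε := by
    simp only [hR, Finset.sum_sub_distrib, ← Finset.mul_sum, hμ.2, hμ'.2]; ring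
  have hQs : ∑ x, Q x = ε := by
    simp only [hQ, Finset.sum_sub_distrib, ← Finset.mul_sum, hν.2, hν'.2]; ring
  -- The only issue is `ε = 0`, where division gives `0`; a nonnegative function of total mass `0`
  -- vanishes, so the identity survives.
  have key : ∀ f : V → ℝ, (∀ x, 0 ≤ f x) → ∑ x, f x = ε → ∀ x, f x * ε / ε = f x := by
    intro f hf hs x
    by_cases h0 : ε = 0
    · rw [h0] at hs ⊢
      rw [(Finset.sum_eq_zero_iff_of_nonneg fun x _ => hf x).1 hs x (Finset.mem_univ x)]
      simp
    · field_simp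
  -- The leftovers `R` and `Q` both have mass `ε`, so `R x * Q y / ε` has marginals `R` and `Q`.
  set B : V → V → ℝ := fun x y => (1 - ε) * A x y + R x * Q y / ε with hB
  have hBc : IsCoupling μ' ν' B := by
    refine isCoupling_of_nonneg hμ' (fun x y => ?_) (fun x => ?_) (fun y => ?_)
    · exact add_nonneg (mul_nonneg (by linarith) (hA.1 x y).1)
        (div_nonneg (mul_nonneg (hR0 x) (hQ0 y)) hε)
    · simp only [hB, Finset.sum_add_distrib, ← Finset.mul_sum, ← Finset.sum_div, hQs, hA.2.1]
      rw [key R hR0 hRs]; simp [hR]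
    · simp only [hB, Finset.sum_add_distrib, ← Finset.mul_sum, ← Finset.sum_div,
        ← Finset.sum_mul, hRs, hA.2.2]
      rw [mul_comm ε, key Q hQ0 hQs]; simp [hQ]
  refine (transport_le_cost hd hBc).trans ?_
  have hc := hA.cost_nonneg hd
  calc ∑ x, ∑ y, B x y * d x y
      ≤ ∑ x, ∑ y, ((1 - ε) * (A x y * d x y) + R x * Q y / ε * D) := by
        refine Finset.sum_le_sum fun x _ => Finset.sum_le_sum fun y _ => ?_
        have : R x * Q y / ε * d x y ≤ R x * Q y / ε * D :=
          mul_le_mul_of_nonneg_left (hD x y) (div_nonneg (mul_nonneg (hR0 x) (hQ0 y)) hε)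
        simp only [hB]; nlinarith
    _ = (1 - ε) * ∑ x, ∑ y, A x y * d x y + ε * D := by
        simp only [Finset.sum_add_distrib, ← Finset.mul_sum, ← Finset.sum_mul, ← Finset.sum_div,
          hQs, hRs]
        by_cases h0 : ε = 0
        · simp [h0]
        · field_simp
    _ ≤ _ := by nlinarith

open Classical in
/-- The point mass at `x` mixed with `p`. -/
noncomputable def lazy (α : ℝ) (x : V) (p : V → ℝ) (y : V) : ℝ :=
  α * (if y = x then 1 else 0) + (1 - α) * p y

lemma isDistribution_lazy {α : ℝ} (h0 : 0 ≤ α) (h1 : α ≤ 1) (x : V) {p : V → ℝ}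
    (hp : IsDistribution p) : IsDistribution (lazy α x p) := by
  classical
  constructor
  · intro y
    refine add_nonneg (mul_nonneg h0 (by split_ifs <;> norm_num))
      (mul_nonneg (by linarith) (hp.1 y))
  · simp only [lazy, Finset.sum_add_distrib, ← Finset.mul_sum, hp.2]
    simp

open Classical in
/-- Rescale a coupling and make up for the change of mass at `(x, y)`. -/
lemma transport_lazy_le {d : V → V → ℝ} (hd : ∀ x y, 0 ≤ d x y) {x y : V} {p q : V → ℝ}
    (hp : IsDistribution p) (hq : IsDistribution q) {α β t : ℝ} (hα0 : 0 ≤ α) (hα : α ≤ 1)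
    (hβ0 : 0 ≤ β) (hβ : β ≤ 1) (ht : 0 ≤ t) (hαβ : 1 - β = t * (1 - α))
    (hm : 0 ≤ t * (2 * α - 1) + (1 - t) ∨ t ≤ 1) :
    transport d (lazy β x p) (lazy β y q) ≤
      t * transport d (lazy α x p) (lazy α y q) + (1 - t) * d x y := by
  have hpα := isDistribution_lazy hα0 hα x hp
  have hqα := isDistribution_lazy hα0 hα y hq
  have hpβ := isDistribution_lazy hβ0 hβ x hp
  have key : ∀ A, IsCoupling (lazy α x p) (lazy α y q) A →
      transport d (lazy β x p) (lazy β y q) ≤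
        t * (∑ u, ∑ v, A u v * d u v) + (1 - t) * d x y := by
    intro A hA
    -- Adding the mass `1 - t` at `(x, y)` turns the laziness `α` into `1 - t * (1 - α) = β` in both
    -- marginals.
    set B : V → V → ℝ := fun u v =>
      t * A u v + (1 - t) * ((if u = x then 1 else 0) * (if v = y then 1 else 0)) with hB
    -- For `t > 1` mass is removed at `(x, y)`, so enough must be there: row `x` carries at least
    -- `α`, and the columns other than `y` absorb at most `1 - α` of it.
    have hAxy : 2 * α - 1 ≤ A x y := by
      have e1 : α ≤ ∑ v, A x v := by
        rw [hA.2.1, lazy]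
        have := mul_nonneg (sub_nonneg.2 hα) (hp.1 x)
        simp; linarith
      have e2 : ∑ v ∈ Finset.univ.erase y, A x v ≤ ∑ v ∈ Finset.univ.erase y, lazy α y q v := by
        refine Finset.sum_le_sum fun v _ => ?_
        rw [← hA.2.2 v]
        exact Finset.single_le_sum (f := fun u => A u v) (fun u _ => (hA.1 u v).1)
          (Finset.mem_univ x)
      have e3 : α ≤ lazy α y q y := by
        rw [lazy]
        have := mul_nonneg (sub_nonneg.2 hα) (hq.1 y)
        simp; linarith
      have e4 := Finset.add_sum_erase Finset.univ (lazy α y q) (Finset.mem_univ y)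
      have e5 := Finset.add_sum_erase Finset.univ (A x) (Finset.mem_univ y)
      rw [hqα.2] at e4
      linarith
    have hBc : IsCoupling (lazy β x p) (lazy β y q) B := by
      refine isCoupling_of_nonneg hpβ (fun u v => ?_) (fun u => ?_) (fun v => ?_)
      · have hAuv := (hA.1 u v).1
        by_cases hu : u = x
        · by_cases hv : v = y
          · subst hu hv
            simp only [hB, if_true, mul_one]
            rcases hm with hm | hm
            · nlinarith
            · nlinarith
          · simp only [hB, if_neg hv, mul_zero, add_zero]; positivity
        · simp only [hB, if_neg hu, zero_mul, mul_zero, add_zero]; positivity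
      · simp only [hB, Finset.sum_add_distrib, ← Finset.mul_sum, hA.2.1]
        simp only [Finset.sum_ite_eq', Finset.mem_univ, if_true, mul_one, lazy]
        rw [show β = 1 - t * (1 - α) by linarith]
        ring
      · simp only [hB, Finset.sum_add_distrib, ← Finset.mul_sum, ← Finset.sum_mul, hA.2.2]
        simp only [Finset.sum_ite_eq', Finset.mem_univ, if_true, one_mul, lazy]
        rw [show β = 1 - t * (1 - α) by linarith]
        ring
    refine (transport_le_cost hd hBc).trans_eq ?_
    simp only [hB, add_mul, Finset.sum_add_distrib, mul_assoc, ← Finset.mul_sum]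
    simp
  rcases ht.eq_or_lt with rfl | ht
  · have := key _ (isCoupling_prod hpα hqα)
    simpa using this
  · rw [← sub_le_iff_le_add, ← div_le_iff₀' ht]
    refine le_transport hpα hqα fun A hA => ?_
    rw [div_le_iff₀' ht, sub_le_iff_le_add]
    exact key A hA

/-- The transportation distance depends affinely on the laziness `α ∈ [1/2, 1)`. -/
lemma transport_lazy {d : V → V → ℝ} (hd : ∀ x y, 0 ≤ d x y) {x y : V} {p q : V → ℝ}
    (hp : IsDistribution p) (hq : IsDistribution q) {α : ℝ} (hα : 1 / 2 ≤ α) (hα1 : α < 1) :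
    transport d (lazy α x p) (lazy α y q) =
      2 * (1 - α) * transport d (lazy (1 / 2) x p) (lazy (1 / 2) y q) +
        (1 - 2 * (1 - α)) * d x y := by
  have hpos : 0 < 1 - α := by linarith
  apply le_antisymm
  · exact transport_lazy_le hd hp hq (by norm_num) (by norm_num) (by linarith) hα1.le
      (by linarith) (by ring) (Or.inr (by linarith))
  -- With this `t` the mass guaranteed at `(x, y)` is used up exactly, so `1/2` is the smallest
  -- laziness that this argument reaches.
  · have := transport_lazy_le hd (x := x) (y := y) hp hq (α := α) (β := 1 / 2)
      (t := 1 / (2 * (1 - α))) (by linarith) hα1.le (by norm_num) (by norm_num) (by positivity)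
      (by field_simp; ring) (Or.inl (by
        have : 1 / (2 * (1 - α)) * (2 * α - 1) + (1 - 1 / (2 * (1 - α))) = 0 := by
          field_simp; ring
        rw [this]))
    have h2 := mul_le_mul_of_nonneg_left this (show 0 ≤ 2 * (1 - α) by linarith)
    have h3 : 2 * (1 - α) * (1 / (2 * (1 - α)) * transport d (lazy α x p) (lazy α y q) +
        (1 - 1 / (2 * (1 - α))) * d x y) =
        transport d (lazy α x p) (lazy α y q) - (1 - 2 * (1 - α)) * d x y := by
      field_simp; ring
    linarith

end Transport

/-! ### Weighted distance, curvature and the vector field of the flow -/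

section Curvature

variable {V : Type*} {γ : ℝ → ℝ} {H : SimpleGraph V} {w w' : Sym2 V → ℝ}

lemma path_sum_nonneg (hw : ∀ e ∈ H.edgeSet, 0 ≤ w e) {x y : V} (p : H.Path x y) :
    0 ≤ (p.1.edges.map w).sum := by
  refine List.sum_nonneg fun a ha => ?_
  obtain ⟨e, he, rfl⟩ := List.mem_map.1 ha
  exact hw e (p.1.edges_subset_edgeSet he)

lemma wdist_nonneg (hw : ∀ e ∈ H.edgeSet, 0 ≤ w e) (x y : V) : 0 ≤ wdist H w x y :=
  Real.iInf_nonneg fun p => path_sum_nonneg hw p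

lemma wdist_le_path (hw : ∀ e ∈ H.edgeSet, 0 ≤ w e) {x y : V} (p : H.Path x y) :
    wdist H w x y ≤ (p.1.edges.map w).sum :=
  ciInf_le ⟨0, by rintro _ ⟨q, rfl⟩; exact path_sum_nonneg hw q⟩ p

lemma wdist_le_edge (hw : ∀ e ∈ H.edgeSet, 0 ≤ w e) {x y : V} (h : H.Adj x y) :
    wdist H w x y ≤ w s(x, y) := by
  simpa [SimpleGraph.Path.singleton] using wdist_le_path hw (SimpleGraph.Path.singleton h)

lemma wdist_comm_le (hw : ∀ e ∈ H.edgeSet, 0 ≤ w e) (x y : V) :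
    wdist H w x y ≤ wdist H w y x := by
  rcases isEmpty_or_nonempty (H.Path y x) with h | h
  · have : IsEmpty (H.Path x y) := ⟨fun p => h.false p.reverse⟩
    simp [wdist, Real.iInf_of_isEmpty]
  · refine le_ciInf fun p => (wdist_le_path hw p.reverse).trans_eq ?_
    simp [SimpleGraph.Path.reverse, List.map_reverse]

lemma wdist_comm (hw : ∀ e ∈ H.edgeSet, 0 ≤ w e) (x y : V) : wdist H w x y = wdist H w y x :=
  le_antisymm (wdist_comm_le hw x y) (wdist_comm_le hw y x)

lemma wdist_congr (h : ∀ e ∈ H.edgeSet, w e = w' e) : wdist H w = wdist H w' := by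
  funext x y
  exact iInf_congr fun p => congrArg _ (List.map_congr_left fun e he =>
    h e (p.1.edges_subset_edgeSet he))

lemma exceedingEdges_congr (h : ∀ e ∈ H.edgeSet, w e = w' e) :
    exceedingEdges H w = exceedingEdges H w' := by
  ext e
  simp only [exceedingEdges, mem_ofPred_eq, wdist_congr h]
  refine exists_congr fun u => exists_congr fun v => and_congr_right fun huv => ?_
  rw [h _ (H.mem_edgeSet.2 huv)]

lemma exceedingEdges_subset : exceedingEdges H w ⊆ H.edgeSet := by
  rintro _ ⟨u, v, huv, rfl, -⟩
  exact huv

/-- Adjacent vertices are distinct, so a path between them has at least one edge. -/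
lemma le_wdist {δ : ℝ} (hδ : 0 ≤ δ) (hw : ∀ e ∈ H.edgeSet, δ ≤ w e) {x y : V} (hxy : H.Adj x y) :
    δ ≤ wdist H w x y := by
  have : Nonempty (H.Path x y) := ⟨SimpleGraph.Path.singleton hxy⟩
  refine le_ciInf fun ⟨p, hp⟩ => ?_
  have hw0 : ∀ e ∈ H.edgeSet, 0 ≤ w e := fun e he => hδ.trans (hw e he)
  cases p with
  | nil => exact absurd rfl hxy.ne
  | cons h q =>
    have h1 := path_sum_nonneg hw0 ⟨q, hp.of_cons⟩
    have h2 := hw _ (H.mem_edgeSet.2 h)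
    simp only [SimpleGraph.Walk.edges_cons, List.map_cons, List.sum_cons] at h1 ⊢
    linarith

lemma wdist_eq_of_exceedingEdges_eq_empty (hw : ∀ e ∈ H.edgeSet, 0 ≤ w e)
    (h : exceedingEdges H w = ∅) {x y : V} (hxy : H.Adj x y) : wdist H w x y = w s(x, y) := by
  refine le_antisymm (wdist_le_edge hw hxy) (not_lt.1 fun hlt => ?_)
  have : s(x, y) ∈ exceedingEdges H w := ⟨x, y, hxy, rfl, hlt⟩
  simp [h] at this

variable [Fintype V]

lemma path_length_le {x y : V} (p : H.Path x y) : (p.1.edges.length : ℝ) ≤ Fintype.card V := by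
  rw [SimpleGraph.Walk.length_edges]
  exact_mod_cast p.2.length_lt.le

lemma list_sum_map_le {ι : Type*} (l : List ι) {f g : ι → ℝ} {η : ℝ}
    (h : ∀ i ∈ l, f i ≤ g i + η) : (l.map f).sum ≤ (l.map g).sum + l.length * η := by
  induction l with
  | nil => simp
  | cons a l ih =>
    have h1 := h a (by simp)
    have h2 := ih fun i hi => h i (by simp [hi])
    simp only [List.map_cons, List.sum_cons, List.length_cons]
    push_cast
    linarith

/-- A path has fewer than `|V|` edges, so an error `η` per edge costs at most `|V| η`. -/
lemma wdist_le_add {η : ℝ} (hη : 0 ≤ η) (hw : ∀ e ∈ H.edgeSet, 0 ≤ w e)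
    (h : ∀ e ∈ H.edgeSet, w e ≤ w' e + η) (x y : V) :
    wdist H w x y ≤ wdist H w' x y + Fintype.card V * η := by
  rcases isEmpty_or_nonempty (H.Path x y) with hp | hp
  · simp only [wdist, Real.iInf_of_isEmpty]; positivity
  · rw [← sub_le_iff_le_add]
    refine le_ciInf fun p => ?_
    rw [sub_le_iff_le_add]
    refine (wdist_le_path hw p).trans ((list_sum_map_le _ fun e he =>
      h e (p.1.edges_subset_edgeSet he)).trans ?_)
    gcongr
    exact_mod_cast path_length_le p

lemma wdist_le_card_mul {Λ : ℝ} (hΛ : 0 ≤ Λ) (hw : ∀ e ∈ H.edgeSet, 0 ≤ w e)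
    (h : ∀ e ∈ H.edgeSet, w e ≤ Λ) (x y : V) : wdist H w x y ≤ Fintype.card V * Λ := by
  have h0 : wdist H (0 : Sym2 V → ℝ) x y = 0 := by
    rcases isEmpty_or_nonempty (H.Path x y) with hp | hp
    · simp [wdist, Real.iInf_of_isEmpty]
    · simp only [wdist]
      refine (iInf_congr fun p => ?_).trans (ciInf_const (a := (0 : ℝ)))
      rw [List.sum_eq_zero]
      simp
  simpa [h0] using wdist_le_add (w' := (0 : Sym2 V → ℝ)) hΛ hw (by simpa using h) x y

lemma wdist_pos (hw : ∀ e ∈ H.edgeSet, 0 < w e) {x y : V} (hxy : H.Adj x y) :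
    0 < wdist H w x y := by
  obtain ⟨e, he, hmin⟩ := (Set.toFinite H.edgeSet).exists_minimalFor w _
    ⟨s(x, y), H.mem_edgeSet.2 hxy⟩
  refine (hw e he).trans_le (le_wdist (hw e he).le (fun f hf => ?_) hxy)
  rcases le_total (w e) (w f) with h | h
  · exact h
  · exact hmin hf h

lemma lazyWalk_eq_lazy (α : ℝ) (x : V) :
    lazyWalk γ H w α x = lazy α x (lazyWalk γ H w 0 x) := by
  funext y
  by_cases h : y = x
  · simp [lazyWalk, lazy, h]
  · simp [lazyWalk, lazy, h]

open Classical in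
lemma sum_neighbors_pos (hγ : ∀ x : ℝ, 0 < x → 0 < γ x) (hw : ∀ e ∈ H.edgeSet, 0 < w e)
    {x y : V} (hxy : H.Adj x y) : 0 < ∑ z with H.Adj x z, γ (w s(x, z)) := by
  refine Finset.sum_pos (fun z hz => hγ _ (hw _ ?_)) ⟨y, by simpa using hxy⟩
  simpa using hz

lemma isDistribution_lazyWalk_zero (hγ : ∀ x : ℝ, 0 < x → 0 < γ x)
    (hw : ∀ e ∈ H.edgeSet, 0 < w e) {x y : V} (hxy : H.Adj x y) :
    IsDistribution (lazyWalk γ H w 0 x) := by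
  classical
  have hs := sum_neighbors_pos hγ hw hxy
  have heq : ∀ z, lazyWalk γ H w 0 x z =
      if H.Adj x z then γ (w s(x, z)) / ∑ z with H.Adj x z, γ (w s(x, z)) else 0 := by
    intro z
    by_cases h : z = x
    · subst h; simp [lazyWalk]
    · simp [lazyWalk, h]
  constructor
  · intro z
    rw [heq]
    split_ifs with h
    · exact div_nonneg (hγ _ (hw _ h)).le hs.le
    · exact le_rfl
  · simp only [heq, ← Finset.sum_filter]
    rw [← Finset.sum_div, div_self hs.ne']

lemma isDistribution_lazyWalk (hγ : ∀ x : ℝ, 0 < x → 0 < γ x) (hw : ∀ e ∈ H.edgeSet, 0 < w e)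
    {x y : V} (hxy : H.Adj x y) {α : ℝ} (h0 : 0 ≤ α) (h1 : α ≤ 1) :
    IsDistribution (lazyWalk γ H w α x) := by
  rw [lazyWalk_eq_lazy]
  exact isDistribution_lazy h0 h1 x (isDistribution_lazyWalk_zero hγ hw hxy)

lemma alphaCurvature_comm (hγ : ∀ x : ℝ, 0 < x → 0 < γ x) (hw : ∀ e ∈ H.edgeSet, 0 < w e)
    {x y : V} (hxy : H.Adj x y) {α : ℝ} (h0 : 0 ≤ α) (h1 : α ≤ 1) :
    alphaCurvature γ H w α x y = alphaCurvature γ H w α y x := by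
  have hw0 : ∀ e ∈ H.edgeSet, 0 ≤ w e := fun e he => (hw e he).le
  rw [alphaCurvature, alphaCurvature, wdist_comm hw0 x y,
    transport_comm (wdist_nonneg hw0) (wdist_comm hw0)
      (isDistribution_lazyWalk hγ hw hxy h0 h1) (isDistribution_lazyWalk hγ hw hxy.symm h0 h1)]

/-- Substituting the affine formula for the transportation distance gives `κ_α = 2 (1 - α) κ_{1/2}`,
so the quotient is constant near `1`. -/
lemma alphaCurvature_div (hγ : ∀ x : ℝ, 0 < x → 0 < γ x) (hw : ∀ e ∈ H.edgeSet, 0 < w e)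
    {x y : V} (hxy : H.Adj x y) {α : ℝ} (h0 : 1 / 2 ≤ α) (h1 : α < 1) :
    alphaCurvature γ H w α x y / (1 - α) = 2 * alphaCurvature γ H w (1 / 2) x y := by
  have hw0 : ∀ e ∈ H.edgeSet, 0 ≤ w e := fun e he => (hw e he).le
  have hd := wdist_pos hw hxy
  have hα : 0 < 1 - α := by linarith
  rw [alphaCurvature, alphaCurvature, lazyWalk_eq_lazy α, lazyWalk_eq_lazy α,
    lazyWalk_eq_lazy (1 / 2), lazyWalk_eq_lazy (1 / 2),
    transport_lazy (wdist_nonneg hw0) (isDistribution_lazyWalk_zero hγ hw hxy)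
      (isDistribution_lazyWalk_zero hγ hw hxy.symm) h0 h1]
  field_simp
  ring

/-- The curvature exists and is determined by the half-lazy random walk. -/
lemma hasRicciCurvature_iff (hγ : ∀ x : ℝ, 0 < x → 0 < γ x) (hw : ∀ e ∈ H.edgeSet, 0 < w e)
    {x y : V} (hxy : H.Adj x y) {k : ℝ} :
    HasRicciCurvature γ H w x y k ↔ k = 2 * alphaCurvature γ H w (1 / 2) x y := by
  have h : HasRicciCurvature γ H w x y (2 * alphaCurvature γ H w (1 / 2) x y) := by
    refine tendsto_const_nhds.congr' ?_
    filter_upwards [Ioo_mem_nhdsLT (show (1 / 2 : ℝ) < 1 by norm_num)] with α hα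
    exact (alphaCurvature_div hγ hw hxy hα.1.le hα.2).symm
  exact ⟨fun hk => tendsto_nhds_unique hk h, fun hk => hk ▸ h⟩

open Classical in
/-- The vector field of the unnormalized Ricci flow, extended by zero to non-edges. -/
noncomputable def field (γ : ℝ → ℝ) (H : SimpleGraph V) (w : Sym2 V → ℝ) (e : Sym2 V) : ℝ :=
  if e ∈ H.edgeSet then -(2 * alphaCurvature γ H w (1 / 2) e.out.1 e.out.2) * w e else 0

lemma field_of_notMem {e : Sym2 V} (he : e ∉ H.edgeSet) : field γ H w e = 0 := if_neg he

lemma field_mk (hγ : ∀ x : ℝ, 0 < x → 0 < γ x) (hw : ∀ e ∈ H.edgeSet, 0 < w e)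
    {x y : V} (hxy : H.Adj x y) :
    field γ H w s(x, y) = -(2 * alphaCurvature γ H w (1 / 2) x y) * w s(x, y) := by
  rw [field, if_pos (H.mem_edgeSet.2 hxy)]
  have h : s(s(x, y).out.1, s(x, y).out.2) = s(x, y) := Quot.out_eq s(x, y)
  -- The chosen representative of the edge may be swapped; symmetry of the curvature makes this
  -- harmless.
  rcases Sym2.eq_iff.1 h with ⟨h1, h2⟩ | ⟨h1, h2⟩
  · rw [h1, h2]
  · rw [h1, h2, alphaCurvature_comm hγ hw hxy (by norm_num) (by norm_num)]

/-- The transportation distance between the half-lazy random walks at `x` and `y`. -/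
noncomputable def halfTransport (γ : ℝ → ℝ) (H : SimpleGraph V) (w : Sym2 V → ℝ) (x y : V) : ℝ :=
  transport (wdist H w) (lazyWalk γ H w (1 / 2) x) (lazyWalk γ H w (1 / 2) y)

lemma field_eq (hγ : ∀ x : ℝ, 0 < x → 0 < γ x) (hw : ∀ e ∈ H.edgeSet, 0 < w e)
    {x y : V} (hxy : H.Adj x y) :
    field γ H w s(x, y) =
      -2 * w s(x, y) + 2 * (halfTransport γ H w x y * w s(x, y) / wdist H w x y) := by
  rw [field_mk hγ hw hxy, alphaCurvature, halfTransport]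
  ring

lemma halfTransport_nonneg (hw : ∀ e ∈ H.edgeSet, 0 ≤ w e) (x y : V) :
    0 ≤ halfTransport γ H w x y := transport_nonneg (wdist_nonneg hw) _ _

lemma halfTransport_le (hγ : ∀ x : ℝ, 0 < x → 0 < γ x) (hw : ∀ e ∈ H.edgeSet, 0 < w e)
    {Λ : ℝ} (hΛ : 0 ≤ Λ) (h : ∀ e ∈ H.edgeSet, w e ≤ Λ) {x y : V} (hxy : H.Adj x y) :
    halfTransport γ H w x y ≤ Fintype.card V * Λ :=
  have hw0 : ∀ e ∈ H.edgeSet, 0 ≤ w e := fun e he => (hw e he).le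
  transport_le (wdist_nonneg hw0) (wdist_le_card_mul hΛ hw0 h)
    (isDistribution_lazyWalk hγ hw hxy (by norm_num) (by norm_num))
    (isDistribution_lazyWalk hγ hw hxy.symm (by norm_num) (by norm_num))

lemma neg_two_mul_le_field (hγ : ∀ x : ℝ, 0 < x → 0 < γ x) (hw : ∀ e ∈ H.edgeSet, 0 < w e)
    {e : Sym2 V} (he : e ∈ H.edgeSet) : -2 * w e ≤ field γ H w e := by
  induction e using Sym2.ind with | _ x y
  have hw0 : ∀ e ∈ H.edgeSet, 0 ≤ w e := fun e he => (hw e he).le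
  rw [field_eq hγ hw he]
  have := div_nonneg (mul_nonneg (halfTransport_nonneg (γ := γ) hw0 x y) (hw0 _ he))
    (wdist_nonneg hw0 x y)
  linarith

/-- This is where the exit condition enters: without exceeding edges `w / d = 1`, leaving `-2w + 2W`
with `W` at most the diameter bound `|V| Λ`. Otherwise `w / d` has no such a priori bound. -/
lemma field_le (hγ : ∀ x : ℝ, 0 < x → 0 < γ x) (hw : ∀ e ∈ H.edgeSet, 0 < w e)
    (h : exceedingEdges H w = ∅) {Λ : ℝ} (hΛ : 0 ≤ Λ) (hle : ∀ e ∈ H.edgeSet, w e ≤ Λ)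
    {e : Sym2 V} (he : e ∈ H.edgeSet) : field γ H w e ≤ 2 * Fintype.card V * Λ := by
  induction e using Sym2.ind with | _ x y
  have hw0 : ∀ e ∈ H.edgeSet, 0 ≤ w e := fun e he => (hw e he).le
  rw [field_eq hγ hw he, wdist_eq_of_exceedingEdges_eq_empty hw0 h he,
    mul_div_assoc, div_self (hw _ he).ne']
  have := halfTransport_le hγ hw hΛ hle he
  have := hw _ he
  linarith

end Curvature

/-! ### Lipschitz dependence of the vector field on the weights -/

section Lipschitz

variable {V : Type*} [Fintype V] {γ : ℝ → ℝ} {H : SimpleGraph V} {w w' : Sym2 V → ℝ}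

/-- A relative error `η` in `γ` lowers a numerator by a factor at least `1 - η` and raises the
normalizing sum by at most `1 + η`; then `(1 - 2η)(1 + η) ≤ 1 - η`. -/
lemma le_of_lazyWalk_close {η : ℝ} (hγ : ∀ x : ℝ, 0 < x → 0 < γ x)
    (hw : ∀ e ∈ H.edgeSet, 0 < w e) (hw' : ∀ e ∈ H.edgeSet, 0 < w' e) (hη : 0 ≤ η)
    (h : ∀ e ∈ H.edgeSet, |γ (w' e) - γ (w e)| ≤ η * γ (w e)) {α : ℝ} (h0 : 0 ≤ α) (h1 : α ≤ 1)
    {x y : V} (hxy : H.Adj x y) (z : V) :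
    (1 - 2 * η) * lazyWalk γ H w α x z ≤ lazyWalk γ H w' α x z := by
  classical
  rw [lazyWalk, lazyWalk]
  split_ifs with hz hxz
  · nlinarith
  · have hS := sum_neighbors_pos hγ hw hxy
    have hS' := sum_neighbors_pos hγ hw' hxy
    have hle : ∑ z with H.Adj x z, γ (w' s(x, z)) ≤
        (1 + η) * ∑ z with H.Adj x z, γ (w s(x, z)) := by
      rw [Finset.mul_sum]
      refine Finset.sum_le_sum fun u hu => ?_
      have := (abs_le.1 (h s(x, u) (by simpa using hu))).2
      linarith
    have hg := hγ _ (hw _ (H.mem_edgeSet.2 hxz))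
    have hg' := hγ _ (hw' _ (H.mem_edgeSet.2 hxz))
    have hgg := (abs_le.1 (h s(x, z) hxz)).1
    rw [mul_left_comm]
    refine mul_le_mul_of_nonneg_left ?_ (by linarith)
    rcases le_or_gt (1 - 2 * η) 0 with hneg | hpos
    · exact (mul_nonpos_of_nonpos_of_nonneg hneg (div_nonneg hg.le hS.le)).trans
        (div_nonneg hg'.le hS'.le)
    · rw [← mul_div_assoc, div_le_div_iff₀ hS hS']
      calc (1 - 2 * η) * γ (w s(x, z)) * ∑ z with H.Adj x z, γ (w' s(x, z))
          ≤ (1 - 2 * η) * γ (w s(x, z)) * ((1 + η) * ∑ z with H.Adj x z, γ (w s(x, z))) := by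
            gcongr
        _ = ((1 - 2 * η) * (1 + η)) * (γ (w s(x, z)) * ∑ z with H.Adj x z, γ (w s(x, z))) := by
            ring
        _ ≤ (1 - η) * (γ (w s(x, z)) * ∑ z with H.Adj x z, γ (w s(x, z))) := by
            refine mul_le_mul_of_nonneg_right (by nlinarith) (mul_pos hg hS).le
        _ = ((1 - η) * γ (w s(x, z))) * ∑ z with H.Adj x z, γ (w s(x, z)) := by ring
        _ ≤ _ := mul_le_mul_of_nonneg_right (by linarith) hS.le
  · simp

/-- The walks are changed first, with the cost fixed, and the cost afterwards. The one-sided bound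
suffices, as `w` and `w'` can be exchanged. -/
lemma exists_halfTransport_le (hγ : ∀ x : ℝ, 0 < x → 0 < γ x)
    (hγlip : ∀ δ M : ℝ, 0 < δ → δ < M → ∃ C : NNReal, LipschitzOnWith C γ (Set.Icc δ M))
    (H : SimpleGraph V) {δ M : ℝ} (hδ : 0 < δ) (hM : δ < M) :
    ∃ C : ℝ, 0 ≤ C ∧ ∀ (w w' : Sym2 V → ℝ) (η : ℝ), 0 ≤ η →
      (∀ e ∈ H.edgeSet, w e ∈ Icc δ M) → (∀ e ∈ H.edgeSet, w' e ∈ Icc δ M) →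
      (∀ e ∈ H.edgeSet, |w' e - w e| ≤ η) → ∀ x y, H.Adj x y →
      halfTransport γ H w' x y ≤ halfTransport γ H w x y + C * η := by
  obtain ⟨C, hC⟩ := hγlip δ M hδ hM
  -- The minimum `γ u > 0` converts the absolute error of `γ` into a relative one.
  obtain ⟨u, hu, hmin⟩ := isCompact_Icc.exists_isMinOn (nonempty_Icc.2 hM.le) hC.continuousOn
  have hγu : 0 < γ u := hγ u (hδ.trans_le hu.1)
  refine ⟨2 * (C / γ u) * (Fintype.card V * M) + Fintype.card V, ?_, ?_⟩
  · have : 0 < M := hδ.trans hM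
    positivity
  intro w w' η hη hw hw' hww x y hxy
  have hp : ∀ e ∈ H.edgeSet, 0 < w e := fun e he => hδ.trans_le (hw e he).1
  have hp' : ∀ e ∈ H.edgeSet, 0 < w' e := fun e he => hδ.trans_le (hw' e he).1
  have hp0 : ∀ e ∈ H.edgeSet, 0 ≤ w e := fun e he => (hp e he).le
  have hp0' : ∀ e ∈ H.edgeSet, 0 ≤ w' e := fun e he => (hp' e he).le
  have hclose : ∀ e ∈ H.edgeSet, |γ (w' e) - γ (w e)| ≤ C / γ u * η * γ (w e) := by
    intro e he
    have h1 := hC.dist_le_mul _ (hw' e he) _ (hw e he)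
    rw [Real.dist_eq, Real.dist_eq] at h1
    have h2 : γ u ≤ γ (w e) := hmin (hw e he)
    calc |γ (w' e) - γ (w e)| ≤ C * |w' e - w e| := h1
      _ ≤ C * η := by gcongr; exact hww e he
      _ = C / γ u * η * γ u := by field_simp
      _ ≤ _ := by gcongr
  have hη' : 0 ≤ C / γ u * η := by positivity
  have hh : (0 : ℝ) ≤ 1 / 2 := by norm_num
  have hh1 : (1 / 2 : ℝ) ≤ 1 := by norm_num
  have e1 : halfTransport γ H w' x y ≤ transport (wdist H w') (lazyWalk γ H w (1 / 2) x)
      (lazyWalk γ H w (1 / 2) y) + 2 * (C / γ u * η) * (Fintype.card V * M) :=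
    transport_le_add_of_le_mul (wdist_nonneg hp0')
      (wdist_le_card_mul (hδ.trans hM).le hp0' fun e he => (hw' e he).2)
      (isDistribution_lazyWalk hγ hp hxy hh hh1) (isDistribution_lazyWalk hγ hp hxy.symm hh hh1)
      (isDistribution_lazyWalk hγ hp' hxy hh hh1) (isDistribution_lazyWalk hγ hp' hxy.symm hh hh1)
      (by positivity)
      (le_of_lazyWalk_close hγ hp hp' hη' hclose hh hh1 hxy)
      (le_of_lazyWalk_close hγ hp hp' hη' hclose hh hh1 hxy.symm)
  have e2 : transport (wdist H w') (lazyWalk γ H w (1 / 2) x) (lazyWalk γ H w (1 / 2) y) ≤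
      halfTransport γ H w x y + Fintype.card V * η :=
    transport_le_add_of_cost_le (wdist_nonneg hp0')
      (wdist_le_add hη hp0' fun e he => by linarith [(abs_le.1 (hww e he)).2])
      (isDistribution_lazyWalk hγ hp hxy hh hh1) (isDistribution_lazyWalk hγ hp hxy.symm hh hh1)
  calc _ ≤ _ := e1
    _ ≤ _ := add_le_add_left e2 _
    _ = _ := by ring

/-- Product and quotient rule for Lipschitz bounds, to be applied to `W * w / d` with `d ≥ δ`. -/
lemma abs_mul_div_sub_le {a b d a' b' d' η A B D δ M N : ℝ} (hδ : 0 < δ)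
    (ha : |a - a'| ≤ A * η) (hb : |b - b'| ≤ B * η) (hd : |d - d'| ≤ D * η)
    (hb0 : |b| ≤ M) (ha0 : |a'| ≤ N) (hb0' : |b'| ≤ M) (hdδ : δ ≤ d) (hdδ' : δ ≤ d') :
    |a * b / d - a' * b' / d'| ≤ ((A * M + N * B) / δ + N * M * D / (δ * δ)) * η := by
  have hd0 : 0 < d := hδ.trans_le hdδ
  have hd0' : 0 < d' := hδ.trans_le hdδ'
  have hM : 0 ≤ M := (abs_nonneg _).trans hb0
  have hN : 0 ≤ N := (abs_nonneg _).trans ha0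
  have heq : a * b / d - a' * b' / d' =
      ((a - a') * b + a' * (b - b')) / d + a' * b' * (d' - d) / (d * d') := by
    field_simp; ring
  have h1 : |((a - a') * b + a' * (b - b')) / d| ≤ (A * η * M + N * (B * η)) / δ := by
    rw [abs_div, abs_of_pos hd0]
    refine div_le_div₀ (add_nonneg (mul_nonneg ((abs_nonneg _).trans ha) hM)
      (mul_nonneg hN ((abs_nonneg _).trans hb))) ((abs_add_le _ _).trans ?_) hδ hdδ
    rw [abs_mul, abs_mul]
    exact add_le_add (mul_le_mul ha hb0 (abs_nonneg _) ((abs_nonneg _).trans ha))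
      (mul_le_mul ha0 hb (abs_nonneg _) hN)
  have h2 : |a' * b' * (d' - d) / (d * d')| ≤ N * M * (D * η) / (δ * δ) := by
    rw [abs_div, abs_of_pos (mul_pos hd0 hd0'), abs_mul, abs_mul, abs_sub_comm]
    refine div_le_div₀ (mul_nonneg (mul_nonneg hN hM) ((abs_nonneg _).trans hd)) ?_
      (mul_pos hδ hδ) (mul_le_mul hdδ hdδ' hδ.le hd0.le)
    exact mul_le_mul (mul_le_mul ha0 hb0' (abs_nonneg _) hN) hd (abs_nonneg _)
      (mul_nonneg hN hM)
  rw [heq]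
  refine (abs_add_le _ _).trans ((add_le_add h1 h2).trans_eq ?_)
  ring

/-- The vector field is Lipschitz as long as the weights stay in a compact interval of positive
numbers. -/
lemma exists_lipschitzOnWith_field [DecidableEq V] (hγ : ∀ x : ℝ, 0 < x → 0 < γ x)
    (hγlip : ∀ δ M : ℝ, 0 < δ → δ < M → ∃ C : NNReal, LipschitzOnWith C γ (Set.Icc δ M))
    (H : SimpleGraph V) {δ M : ℝ} (hδ : 0 < δ) (hM : δ < M) :
    ∃ C : NNReal, LipschitzOnWith C (field γ H) {w | ∀ e ∈ H.edgeSet, w e ∈ Icc δ M} := by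
  obtain ⟨C, hC0, hC⟩ := exists_halfTransport_le hγ hγlip H hδ hM
  have hM0 : 0 < M := hδ.trans hM
  set n : ℝ := ((Fintype.card V : ℕ) : ℝ) with hn
  have hn0 : 0 ≤ n := by positivity
  -- The constants of `abs_mul_div_sub_le` for `W * w / d`: Lipschitz constants `C`, `1`, `n`, and
  -- bounds `n * M` for `W` and `M` for `w`. The leading `2` comes from the term `-2w`.
  set L : ℝ := 2 + 2 * ((C * M + n * M * 1) / δ + n * M * M * n / (δ * δ)) with hL
  have hL0 : 0 ≤ L := by positivity
  refine ⟨⟨L, hL0⟩, LipschitzOnWith.of_dist_le_mul fun w hw w' hw' => ?_⟩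
  set η := dist w w' with hη
  have hη0 : 0 ≤ η := dist_nonneg
  have hww : ∀ e, |w e - w' e| ≤ η := fun e => dist_le_pi_dist w w' e
  have hww' : ∀ e, |w' e - w e| ≤ η := fun e => by rw [abs_sub_comm]; exact hww e
  have hp : ∀ e ∈ H.edgeSet, 0 < w e := fun e he => hδ.trans_le (hw e he).1
  have hp' : ∀ e ∈ H.edgeSet, 0 < w' e := fun e he => hδ.trans_le (hw' e he).1
  have hp0 : ∀ e ∈ H.edgeSet, 0 ≤ w e := fun e he => (hp e he).le
  have hp0' : ∀ e ∈ H.edgeSet, 0 ≤ w' e := fun e he => (hp' e he).le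
  change _ ≤ L * η
  refine (dist_pi_le_iff (mul_nonneg hL0 hη0)).2 fun e => ?_
  by_cases he : e ∈ H.edgeSet
  swap
  · rw [field_of_notMem he, field_of_notMem he, dist_self]
    exact mul_nonneg hL0 hη0
  induction e using Sym2.ind with | _ x y
  rw [field_eq hγ hp he, field_eq hγ hp' he, Real.dist_eq]
  have hW : |halfTransport γ H w x y - halfTransport γ H w' x y| ≤ C * η := by
    rw [abs_le]
    constructor
    · linarith [hC w w' η hη0 hw hw' (fun e _ => hww' e) x y he]
    · linarith [hC w' w η hη0 hw' hw (fun e _ => hww e) x y he]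
  have hd : |wdist H w x y - wdist H w' x y| ≤ n * η := by
    rw [abs_le]
    constructor
    · linarith [wdist_le_add hη0 hp0' (fun e _ => by linarith [(abs_le.1 (hww' e)).2]) x y
        (w' := w)]
    · linarith [wdist_le_add hη0 hp0 (fun e _ => by linarith [(abs_le.1 (hww e)).2]) x y
        (w' := w')]
  have hkey := abs_mul_div_sub_le (M := M) (N := n * M) hδ hW ((hww s(x, y)).trans_eq (one_mul η).symm) hd
    (by rw [abs_of_pos (hp _ he)]; exact (hw _ he).2)
    (by rw [abs_of_nonneg (halfTransport_nonneg hp0' x y)]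
        exact halfTransport_le hγ hp' hM0.le (fun e he => (hw' e he).2) he)
    (by rw [abs_of_pos (hp' _ he)]; exact (hw' _ he).2)
    (le_wdist hδ.le (fun e he => (hw e he).1) he) (le_wdist hδ.le (fun e he => (hw' e he).1) he)
  rw [abs_le] at hkey ⊢
  have h3 := abs_le.1 (hww s(x, y))
  rw [hL, add_mul, mul_assoc 2 _ η]
  constructor
  · linarith [hkey.1, h3.2]
  · linarith [hkey.2, h3.1]

end Lipschitz

/-! ### Barrier arguments -/

section Barrier

/-- Functions satisfying `f' ≥ -2 f` as long as all of them are positive remain positive. -/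
lemma forall_pos_of_deriv_ge {ι : Type*} [Finite ι] {f : ι → ℝ → ℝ} {a b : ℝ}
    (hc : ∀ i, ContinuousOn (f i) (Icc a b)) (h0 : ∀ i, 0 < f i a)
    (hd : ∀ t ∈ Ico a b, (∀ i, 0 < f i t) →
      ∀ i, ∃ f', HasDerivWithinAt (f i) f' (Ici t) t ∧ -2 * f i t ≤ f') :
    ∀ t ∈ Icc a b, ∀ i, 0 < f i t := by
  by_contra! hcon
  have hclosed : IsClosed (⋃ i, {t ∈ Icc a b | f i t ≤ 0}) :=
    isClosed_iUnion_of_finite fun i =>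
      (hc i).preimage_isClosed_of_isClosed isClosed_Icc (isClosed_Iic (a := (0 : ℝ)))
  have hcomp : IsCompact (⋃ i, {t ∈ Icc a b | f i t ≤ 0}) :=
    isCompact_Icc.of_isClosed_subset hclosed (iUnion_subset fun i t ht => ht.1)
  obtain ⟨t₁, ht₁, i₁, hi₁⟩ := hcon
  -- The first time at which some function fails to be positive; before it the differential
  -- inequality is available.
  obtain ⟨τ, hτ, hmin⟩ := hcomp.exists_isLeast ⟨t₁, mem_iUnion.2 ⟨i₁, ht₁, hi₁⟩⟩
  obtain ⟨i, hτI, hi⟩ := mem_iUnion.1 hτ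
  have hpos : ∀ t ∈ Ico a τ, ∀ j, 0 < f j t := by
    intro t ht j
    by_contra! hj
    exact absurd (hmin (mem_iUnion.2 ⟨j, ⟨ht.1, ht.2.le.trans hτI.2⟩, hj⟩)) (not_le.2 ht.2)
  have hder : ∀ t ∈ Ico a τ, HasDerivWithinAt (f i) (derivWithin (f i) (Ici t) t) (Ici t) t ∧
      -2 * f i t ≤ derivWithin (f i) (Ici t) t := by
    intro t ht
    obtain ⟨f', hf', hle⟩ := hd t ⟨ht.1, ht.2.trans_le hτI.2⟩ (hpos t ht) i
    rw [hf'.derivWithin (uniqueDiffWithinAt_Ici t)]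
    exact ⟨hf', hle⟩
  have hexp : ∀ t : ℝ, HasDerivAt (fun t => Real.exp (2 * t)) (Real.exp (2 * t) * (2 * 1)) t :=
    fun t => ((hasDerivAt_id t).const_mul 2).exp
  -- Up to `τ` the function `f i t * exp (2t)` has nonnegative right derivative, so it cannot fall
  -- below its positive initial value.
  have key := image_le_of_deriv_right_le_deriv_boundary (a := a) (b := τ)
    (f := fun _ => f i a * Real.exp (2 * a)) (f' := fun _ => 0)
    (B := fun t => f i t * Real.exp (2 * t))
    (B' := fun t => derivWithin (f i) (Ici t) t * Real.exp (2 * t) +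
      f i t * (Real.exp (2 * t) * (2 * 1)))
    continuousOn_const (fun t _ => hasDerivWithinAt_const _ _ _) le_rfl
    (((hc i).mono (Icc_subset_Icc_right hτI.2)).mul (by fun_prop))
    (fun t ht => (hder t ht).1.mul (hexp t).hasDerivWithinAt)
    (fun t ht => by
      have := (hder t ht).2
      have he := Real.exp_pos (2 * t)
      nlinarith)
    (right_mem_Icc.2 hτI.1)
  have h1 : 0 < f i a * Real.exp (2 * a) := mul_pos (h0 i) (Real.exp_pos _)
  have h2 : f i τ * Real.exp (2 * τ) ≤ 0 :=
    mul_nonpos_of_nonpos_of_nonneg hi (Real.exp_pos _).le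
  exact absurd (h1.trans_le key) (not_lt.2 h2)

lemma exists_bounds_of_pos {ι : Type*} [Finite ι] {f : ι → ℝ → ℝ} {K : Set ℝ}
    (hK : IsCompact K) (hc : ∀ i, ContinuousOn (f i) K) (h0 : ∀ i, ∀ t ∈ K, 0 < f i t) :
    ∃ δ M : ℝ, 0 < δ ∧ δ < M ∧ ∀ i, ∀ t ∈ K, f i t ∈ Icc δ M := by
  have h1 : ∀ i, ∃ l > 0, ∀ t ∈ K, l ≤ f i t := by
    intro i
    rcases K.eq_empty_or_nonempty with rfl | hne
    · exact ⟨1, one_pos, by simp⟩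
    · obtain ⟨t, ht, hmin⟩ := hK.exists_isMinOn hne (hc i)
      exact ⟨f i t, h0 i t ht, fun s hs => hmin hs⟩
  have h2 : ∀ i, ∃ u, ∀ t ∈ K, f i t ≤ u := by
    intro i
    obtain ⟨u, hu⟩ := (hK.image_of_continuousOn (hc i)).bddAbove
    exact ⟨u, fun t ht => hu (mem_image_of_mem _ ht)⟩
  choose l hl hlf using h1
  choose u huf using h2
  -- Choosing a small `δ` and a large `M` by filters also covers an empty index type.
  obtain ⟨δ, hδl, hδ⟩ := ((eventually_all.2 fun i => (Ioc_mem_nhdsGT (hl i) :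
    ∀ᶠ δ in 𝓝[>] (0 : ℝ), δ ∈ Ioc 0 (l i))).and
      (self_mem_nhdsWithin : Ioi (0 : ℝ) ∈ 𝓝[>] 0)).exists
  obtain ⟨M, hMu, hM⟩ := ((eventually_all.2 fun i => eventually_ge_atTop (u i)).and
    (eventually_gt_atTop δ)).exists
  exact ⟨δ, M, hδ, hM, fun i t ht => ⟨(hδl i).2.trans (hlf i t ht), (huf i t ht).trans (hMu i)⟩⟩

end Barrier

/-! ### Positivity, uniqueness and existence of solutions on a fixed graph -/

section Solutions

variable {V : Type*} {γ : ℝ → ℝ} {H : SimpleGraph V} {X Y : ℝ → Sym2 V → ℝ}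
  {w w' : Sym2 V → ℝ} {I J : Set ℝ}

variable [Fintype V]

lemma lazyWalk_congr (h : ∀ e ∈ H.edgeSet, w e = w' e) (α : ℝ) (x : V) :
    lazyWalk γ H w α x = lazyWalk γ H w' α x := by
  classical
  funext y
  have hs : ∑ z with H.Adj x z, γ (w s(x, z)) = ∑ z with H.Adj x z, γ (w' s(x, z)) :=
    Finset.sum_congr rfl fun z hz => by rw [h _ (by simpa using hz)]
  simp only [lazyWalk]
  split_ifs with h1 h2
  · rfl
  · rw [hs, h _ (H.mem_edgeSet.2 h2)]
  · rfl

lemma field_congr (h : ∀ e ∈ H.edgeSet, w e = w' e) : field γ H w = field γ H w' := by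
  funext e
  simp only [field]
  split_ifs with he
  · rw [h e he, alphaCurvature, alphaCurvature, wdist_congr h, lazyWalk_congr h,
      lazyWalk_congr h]
  · rfl

lemma IsSolutionOn.mono (hX : IsSolutionOn γ H X J) (h : I ⊆ J) : IsSolutionOn γ H X I :=
  fun t ht => ⟨(hX t (h ht)).1, fun x y hxy =>
    let ⟨k, hk, hd⟩ := (hX t (h ht)).2 x y hxy
    ⟨k, hk, hd.mono h⟩⟩

lemma IsSolutionOn.continuousOn (hX : IsSolutionOn γ H X I) {e : Sym2 V} (he : e ∈ H.edgeSet) :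
    ContinuousOn (fun t => X t e) I := by
  induction e using Sym2.ind with | _ x y
  intro t ht
  obtain ⟨k, -, hd⟩ := (hX t ht).2 x y he
  exact hd.continuousWithinAt

lemma IsSolutionOn.hasDerivWithinAt (hγ : ∀ x : ℝ, 0 < x → 0 < γ x) (hX : IsSolutionOn γ H X I)
    {t : ℝ} (ht : t ∈ I) (hpos : ∀ e ∈ H.edgeSet, 0 < X t e) {e : Sym2 V} (he : e ∈ H.edgeSet) :
    HasDerivWithinAt (fun τ => X τ e) (field γ H (X t) e) I t := by
  induction e using Sym2.ind with | _ x y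
  obtain ⟨k, hk, hd⟩ := (hX t ht).2 x y he
  rw [hasRicciCurvature_iff hγ hpos he] at hk
  rwa [field_mk hγ hpos he, ← hk]

lemma isSolutionOn_of_hasDerivWithinAt (hγ : ∀ x : ℝ, 0 < x → 0 < γ x)
    (h : ∀ t ∈ I, (∀ e ∈ H.edgeSet, 0 < X t e) ∧
      ∀ e ∈ H.edgeSet, HasDerivWithinAt (fun τ => X τ e) (field γ H (X t) e) I t) :
    IsSolutionOn γ H X I := by
  intro t ht
  obtain ⟨hpos, hd⟩ := h t ht
  refine ⟨fun e he => (hpos e he).le, fun x y hxy =>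
    ⟨_, (hasRicciCurvature_iff hγ hpos hxy).2 rfl, ?_⟩⟩
  rw [← field_mk hγ hpos hxy]
  exact hd _ hxy

lemma Ico_mem_nhdsWithin_Ici_of_mem {s b t : ℝ} (ht : t ∈ Ico s b) : Ico s b ∈ 𝓝[≥] t :=
  mem_of_superset (Ico_mem_nhdsGE ht.2) (Ico_subset_Ico_left ht.1)

/-- Weights that are positive at the start remain positive. -/
lemma IsSolutionOn.pos (hγ : ∀ x : ℝ, 0 < x → 0 < γ x) {s b : ℝ}
    (hX : IsSolutionOn γ H X (Ico s b)) (h0 : ∀ e ∈ H.edgeSet, 0 < X s e) {t : ℝ}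
    (ht : t ∈ Ico s b) : ∀ e ∈ H.edgeSet, 0 < X t e := by
  have := forall_pos_of_deriv_ge (ι := H.edgeSet) (f := fun e τ => X τ e) (a := s) (b := t)
    (fun e => (hX.continuousOn e.2).mono (Icc_subset_Ico_right ht.2)) (fun e => h0 e e.2)
    -- The equation is known to involve `field` only when all weights are positive, which is exactly
    -- when the barrier asks for the derivative.
    (fun τ hτ hpos e => by
      have hτb : τ ∈ Ico s b := ⟨hτ.1, hτ.2.trans ht.2⟩
      have hp : ∀ e ∈ H.edgeSet, 0 < X τ e := fun e he => hpos ⟨e, he⟩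
      exact ⟨_, (hX.hasDerivWithinAt hγ hτb hp e.2).mono_of_mem_nhdsWithin
        (Ico_mem_nhdsWithin_Ici_of_mem hτb), neg_two_mul_le_field hγ hp e.2⟩)
    t (right_mem_Icc.2 ht.1)
  exact fun e he => this ⟨e, he⟩

/-- On the compact interval `[s, t]` both solutions are continuous and positive, so they share a box
on which the vector field is Lipschitz, and the Grönwall uniqueness theorem applies. -/
lemma IsSolutionOn.eqOn (hγ : ∀ x : ℝ, 0 < x → 0 < γ x)
    (hγlip : ∀ δ M : ℝ, 0 < δ → δ < M → ∃ C : NNReal, LipschitzOnWith C γ (Set.Icc δ M))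
    {s b : ℝ} (hX : IsSolutionOn γ H X (Ico s b)) (hY : IsSolutionOn γ H Y (Ico s b))
    (h0 : ∀ e ∈ H.edgeSet, 0 < X s e) (hXY : ∀ e ∈ H.edgeSet, X s e = Y s e) {t : ℝ}
    (ht : t ∈ Ico s b) : ∀ e ∈ H.edgeSet, X t e = Y t e := by
  classical
  have hsub : Icc s t ⊆ Ico s b := Icc_subset_Ico_right ht.2
  have hXp : ∀ τ ∈ Icc s t, ∀ e ∈ H.edgeSet, 0 < X τ e := fun τ hτ => hX.pos hγ h0 (hsub hτ)
  have hYp : ∀ τ ∈ Icc s t, ∀ e ∈ H.edgeSet, 0 < Y τ e := fun τ hτ =>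
    hY.pos hγ (fun e he => hXY e he ▸ h0 e he) (hsub hτ)
  obtain ⟨δ, M, hδ, hM, hbd⟩ := exists_bounds_of_pos (ι := H.edgeSet ⊕ H.edgeSet)
    (f := Sum.elim (fun e τ => X τ e) (fun e τ => Y τ e)) (isCompact_Icc (a := s) (b := t))
    (by
      rintro (e | e)
      · exact (hX.continuousOn e.2).mono hsub
      · exact (hY.continuousOn e.2).mono hsub)
    (by
      rintro (e | e) τ hτ
      · exact hXp τ hτ e e.2
      · exact hYp τ hτ e e.2)
  obtain ⟨C, hC⟩ := exists_lipschitzOnWith_field hγ hγlip H hδ hM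
  -- Values of a solution off the edges are arbitrary, possibly discontinuous in time, so they are
  -- replaced by `0`.
  let R : (ℝ → Sym2 V → ℝ) → ℝ → Sym2 V → ℝ := fun Z τ e => if e ∈ H.edgeSet then Z τ e else 0
  have hR : ∀ Z τ, ∀ e ∈ H.edgeSet, R Z τ e = Z τ e := fun Z τ e he => if_pos he
  have hRc : ∀ Z, IsSolutionOn γ H Z (Ico s b) → ContinuousOn (R Z) (Icc s t) := by
    intro Z hZ
    refine continuousOn_pi.2 fun e => ?_
    by_cases he : e ∈ H.edgeSet
    · simpa only [R, if_pos he] using (hZ.continuousOn he).mono hsub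
    · simpa only [R, if_neg he] using continuousOn_const
  have hRd : ∀ Z, IsSolutionOn γ H Z (Ico s b) →
      (∀ τ ∈ Icc s t, ∀ e ∈ H.edgeSet, 0 < Z τ e) → ∀ τ ∈ Ico s t,
      HasDerivWithinAt (R Z) (field γ H (R Z τ)) (Ici τ) τ := by
    intro Z hZ hZp τ hτ
    rw [field_congr (hR Z τ)]
    refine hasDerivWithinAt_pi.2 fun e => ?_
    have hτb := hsub (Ico_subset_Icc_self hτ)
    by_cases he : e ∈ H.edgeSet
    · simpa only [R, if_pos he] using (hZ.hasDerivWithinAt hγ hτb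
        (hZp τ (Ico_subset_Icc_self hτ)) he).mono_of_mem_nhdsWithin
          (Ico_mem_nhdsWithin_Ici_of_mem hτb)
    · simpa only [R, if_neg he, field_of_notMem he] using hasDerivWithinAt_const _ _ _
  have key := ODE_solution_unique_of_mem_Icc_right (v := fun _ => field γ H)
    (s := fun _ => {w | ∀ e ∈ H.edgeSet, w e ∈ Icc δ M}) (fun _ _ => hC)
    (hRc X hX) (hRd X hX hXp)
    (fun τ hτ e he => (hR X τ e he).symm ▸ hbd (Sum.inl ⟨e, he⟩) τ (Ico_subset_Icc_self hτ))
    (hRc Y hY) (hRd Y hY hYp)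
    (fun τ hτ e he => (hR Y τ e he).symm ▸ hbd (Sum.inr ⟨e, he⟩) τ (Ico_subset_Icc_self hτ))
    (by
      funext e
      by_cases he : e ∈ H.edgeSet
      · rw [hR X s e he, hR Y s e he, hXY e he]
      · simp [R, he])
    (right_mem_Icc.2 ht.1)
  intro e he
  rw [← hR X t e he, ← hR Y t e he, key]

/-- A bounded Lipschitz vector field has solutions on arbitrary compact time intervals. -/
lemma exists_solution_of_lipschitzWith {E : Type*} [NormedAddCommGroup E] [NormedSpace ℝ E]
    [CompleteSpace E] {F : E → E} {C L : NNReal} (hF : LipschitzWith C F) (hL : ∀ x, ‖F x‖ ≤ L)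
    (x₀ : E) {s N : ℝ} (h : s ≤ N) :
    ∃ Z : ℝ → E, Z s = x₀ ∧ ∀ t ∈ Icc s N, HasDerivWithinAt Z (F (Z t)) (Icc s N) t := by
  have hPL : IsPicardLindelof (fun _ => F) (⟨s, left_mem_Icc.2 h⟩ : Icc s N) x₀
      (L * (N - s).toNNReal) 0 L C := by
    refine IsPicardLindelof.of_time_independent (fun x _ => hL x) hF.lipschitzOnWith ?_
    simp [max_eq_left (sub_nonneg.2 h), Real.coe_toNNReal _ (sub_nonneg.2 h)]
  exact hPL.exists_eq_forall_mem_Icc_hasDerivWithinAt₀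

/-- Either there is a solution on `[s, N)` that never meets the exit condition, or there is a
solution on some interval that meets it. -/
lemma exists_solution (hγ : ∀ x : ℝ, 0 < x → 0 < γ x)
    (hγlip : ∀ δ M : ℝ, 0 < δ → δ < M → ∃ C : NNReal, LipschitzOnWith C γ (Set.Icc δ M))
    {w₀ : Sym2 V → ℝ} (hw₀ : ∀ e ∈ H.edgeSet, 0 < w₀ e) {s N : ℝ} (hN : s < N) :
    ∃ (b : ℝ) (X : ℝ → Sym2 V → ℝ), s < b ∧ IsSolutionOn γ H X (Ico s b) ∧
      (∀ e ∈ H.edgeSet, X s e = w₀ e) ∧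
      ((b = N ∧ ∀ t ∈ Ico s N, exceedingEdges H (X t) = ∅) ∨
        ∃ t ∈ Ico s b, (exceedingEdges H (X t)).Nonempty) := by
  classical
  obtain ⟨m, M, hm, hmM, hbd⟩ : ∃ m M : ℝ, 0 < m ∧ m < M ∧ ∀ e ∈ H.edgeSet, w₀ e ∈ Ioo m M := by
    obtain ⟨m, M, hm, hmM, h⟩ := exists_bounds_of_pos (ι := H.edgeSet) (K := {(0 : ℝ)})
      (f := fun e _ => w₀ e) isCompact_singleton (fun _ => continuousOn_const)
      (fun e _ _ => hw₀ e e.2)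
    refine ⟨m / 2, M + 1, half_pos hm, by linarith, fun e he => ?_⟩
    have := h ⟨e, he⟩ 0 rfl
    exact ⟨by linarith [this.1], by linarith [this.2]⟩
  set c : ℝ := 2 * Fintype.card V with hc
  have hc0 : 0 ≤ c := by positivity
  have hM0 : 0 < M := hm.trans hmM
  -- The barriers solve `lo' = -2 lo` and `hi' = c hi`, the extreme rates allowed by
  -- `neg_two_mul_le_field` and `field_le`.
  set lo : ℝ → ℝ := fun t => m * Real.exp (-2 * (t - s)) with hlo
  set hi : ℝ → ℝ := fun t => M * Real.exp (c * (t - s)) with hhi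
  have hlo0 : ∀ t, 0 < lo t := fun t => by positivity
  have hhi0 : ∀ t, 0 < hi t := fun t => by positivity
  have hloN : ∀ t ≤ N, lo N ≤ lo t := fun t ht => by
    simp only [hlo]; gcongr ?_ * Real.exp ?_; linarith
  have hhiN : ∀ t ≤ N, hi t ≤ hi N := fun t ht => by
    simp only [hhi]; gcongr
  have hlohi : lo N < hi N := by
    have h1 : lo N ≤ lo s := hloN s hN.le
    have h2 : hi s ≤ hi N := hhiN s hN.le
    simp only [hlo, hhi, sub_self, mul_zero, Real.exp_zero, mul_one] at h1 h2 ⊢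
    linarith
  have hlod : ∀ t, HasDerivAt lo (-2 * lo t) t := fun t => by
    have := ((((hasDerivAt_id t).sub_const s).const_mul (-2)).exp).const_mul m
    refine this.congr_deriv ?_
    simp only [hlo, id]; ring
  have hhid : ∀ t, HasDerivAt hi (c * hi t) t := fun t => by
    have := ((((hasDerivAt_id t).sub_const s).const_mul c).exp).const_mul M
    refine this.congr_deriv ?_
    simp only [hhi, id]; ring
  obtain ⟨C, hC⟩ := exists_lipschitzOnWith_field hγ hγlip H (hlo0 N) hlohi
  -- Clamping every weight to `[lo N, hi N]` makes the vector field bounded and globally Lipschitz,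
  -- without changing it inside the box.
  let P : (Sym2 V → ℝ) → Sym2 V → ℝ := fun w e => projIcc (lo N) (hi N) hlohi.le (w e)
  have hP : LipschitzWith 1 P := LipschitzWith.of_dist_le_mul fun w w' => by
    rw [NNReal.coe_one, one_mul]
    refine (dist_pi_le_iff dist_nonneg).2 fun e => ?_
    exact ((LipschitzWith.projIcc hlohi.le).dist_le_mul (w e) (w' e)).trans (by
      simpa using dist_le_pi_dist w w' e)
  have hPmem : ∀ w e, P w e ∈ Icc (lo N) (hi N) := fun w e => Subtype.prop _
  have hG : LipschitzWith (C * 1) (fun w => field γ H (P w)) := by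
    rw [← lipschitzOnWith_univ] at hP ⊢
    exact hC.comp hP fun w _ e _ => hPmem w e
  have hGb : ∀ w, ‖field γ H (P w)‖ ≤
      (‖field γ H (P 0)‖₊ + C * (hi N - lo N).toNNReal : NNReal) := by
    intro w
    have h1 := hC.dist_le_mul (P w) (fun e _ => hPmem w e) (P 0) (fun e _ => hPmem 0 e)
    have h2 : dist (P w) (P 0) ≤ hi N - lo N := by
      refine (dist_pi_le_iff (sub_pos.2 hlohi).le).2 fun e => ?_
      exact Real.dist_le_of_mem_Icc (hPmem w e) (hPmem 0 e)
    rw [dist_eq_norm] at h1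
    have h3 := norm_le_norm_add_norm_sub' (field γ H (P w)) (field γ H (P 0))
    have h4 : (C : ℝ) * dist (P w) (P 0) ≤ C * (hi N - lo N) := by gcongr
    rw [NNReal.coe_add, NNReal.coe_mul, coe_nnnorm, Real.coe_toNNReal _ (sub_pos.2 hlohi).le]
    linarith
  obtain ⟨Z, hZs, hZ⟩ := exists_solution_of_lipschitzWith hG hGb w₀ hN.le
  have hZe : ∀ e, ∀ t ∈ Icc s N,
      HasDerivWithinAt (fun τ => Z τ e) (field γ H (P (Z t)) e) (Icc s N) t :=
    fun e t ht => hasDerivWithinAt_pi.1 (hZ t ht) e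
  have hZc : ∀ e, ContinuousOn (fun τ => Z τ e) (Icc s N) :=
    fun e t ht => (hZe e t ht).continuousWithinAt
  have hbox : ∀ t, (∀ e ∈ H.edgeSet, Z t e ∈ Icc (lo N) (hi N)) →
      field γ H (P (Z t)) = field γ H (Z t) := fun t ht =>
    field_congr fun e he => by simp only [P]; rw [projIcc_of_mem _ (ht e he)]
  have hsol : ∀ b ≤ N, (∀ t ∈ Ico s b, ∀ e ∈ H.edgeSet, Z t e ∈ Icc (lo N) (hi N)) →
      IsSolutionOn γ H Z (Ico s b) := by
    intro b hb h
    refine isSolutionOn_of_hasDerivWithinAt hγ fun t ht =>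
      ⟨fun e he => (hlo0 N).trans_le (h t ht e he).1, fun e he => ?_⟩
    rw [← hbox t (h t ht)]
    exact (hZe e t ⟨ht.1, ht.2.le.trans hb⟩).mono fun τ hτ => ⟨hτ.1, hτ.2.le.trans hb⟩
  have hbarrier : ∀ T ∈ Icc s N, (∀ t ∈ Ico s T, exceedingEdges H (Z t) = ∅) →
      ∀ t ∈ Icc s T, ∀ e ∈ H.edgeSet, Z t e ∈ Ioo (lo N) (hi N) := by
    intro T hT hno t ht e he
    -- While positive, both gaps satisfy `f' ≥ -2 f`: `(Z - lo)' ≥ -2 (Z - lo)`, and `(hi - Z)' ≥ c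
    -- hi - c hi = 0`.
    have key := forall_pos_of_deriv_ge (ι := H.edgeSet ⊕ H.edgeSet) (a := s) (b := T)
      (f := Sum.elim (fun e τ => Z τ e - lo τ) (fun e τ => hi τ - Z τ e))
      (by
        rintro (e | e)
        · exact ((hZc e).mono (Icc_subset_Icc_right hT.2)).sub
            fun τ _ => (hlod τ).continuousAt.continuousWithinAt
        · exact ContinuousOn.sub (fun τ _ => (hhid τ).continuousAt.continuousWithinAt)
            ((hZc e).mono (Icc_subset_Icc_right hT.2)))
      (by
        rintro (e | e)
        · simpa [hZs, hlo] using (hbd e e.2).1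
        · simpa [hZs, hhi] using (hbd e e.2).2)
      (by
        intro τ hτ hpos
        have hτN : τ < N := hτ.2.trans_le hT.2
        have h1 : ∀ e ∈ H.edgeSet, lo τ < Z τ e := fun e he =>
          sub_pos.1 (hpos (Sum.inl ⟨e, he⟩))
        have h2 : ∀ e ∈ H.edgeSet, Z τ e < hi τ := fun e he =>
          sub_pos.1 (hpos (Sum.inr ⟨e, he⟩))
        have hp : ∀ e ∈ H.edgeSet, 0 < Z τ e := fun e he => (hlo0 τ).trans (h1 e he)
        have hb := hbox τ fun e he => ⟨(hloN τ hτN.le).trans (h1 e he).le,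
          (h2 e he).le.trans (hhiN τ hτN.le)⟩
        have hd : ∀ e, HasDerivWithinAt (fun τ => Z τ e) (field γ H (Z τ) e) (Ici τ) τ := by
          intro e
          rw [← hb]
          exact (hZe e τ ⟨hτ.1, hτN.le⟩).mono_of_mem_nhdsWithin
            (mem_of_superset (Ico_mem_nhdsWithin_Ici_of_mem ⟨hτ.1, hτN⟩) Ico_subset_Icc_self)
        rintro (e | e)
        · refine ⟨_, (hd e).sub (hlod τ).hasDerivWithinAt, ?_⟩
          have := neg_two_mul_le_field hγ hp e.2
          simp only [Sum.elim_inl]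
          linarith
        · refine ⟨_, (hhid τ).hasDerivWithinAt.sub (hd e), ?_⟩
          have h3 := field_le hγ hp (hno τ hτ) (hhi0 τ).le (fun e he => (h2 e he).le) e.2
          have h4 := h2 e e.2
          simp only [Sum.elim_inr]
          rw [← hc] at h3
          linarith)
      t ht
    have htN : t ≤ N := ht.2.trans hT.2
    exact ⟨(hloN t htN).trans_lt (sub_pos.1 (key (Sum.inl ⟨e, he⟩))),
      (sub_pos.1 (key (Sum.inr ⟨e, he⟩))).trans_le (hhiN t htN)⟩
  have hinit : ∀ e ∈ H.edgeSet, Z s e = w₀ e := fun e _ => by rw [hZs]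
  by_cases hno : ∀ t ∈ Ico s N, exceedingEdges H (Z t) = ∅
  · refine ⟨N, Z, hN, hsol N le_rfl fun t ht e he => ?_, hinit, Or.inl ⟨rfl, hno⟩⟩
    exact Ioo_subset_Icc_self
      (hbarrier N (right_mem_Icc.2 hN.le) hno t (Ico_subset_Icc_self ht) e he)
  · push Not at hno
    obtain ⟨t₁, ht₁, hne⟩ := hno
    set S : Set ℝ := {t ∈ Ico s N | (exceedingEdges H (Z t)).Nonempty} with hS
    have hSbd : BddBelow S := ⟨s, fun t ht => ht.1.1⟩
    have hT : IsGLB S (sInf S) := isGLB_csInf ⟨t₁, ht₁, hne⟩ hSbd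
    have hsT : s ≤ sInf S := hT.2 fun t ht => ht.1.1
    have hTN : sInf S < N := (hT.1 ⟨ht₁, hne⟩).trans_lt ht₁.2
    have hbefore := hbarrier (sInf S) ⟨hsT, hTN.le⟩ fun t ht => by
      by_contra h
      exact absurd (hT.1 ⟨⟨ht.1, ht.2.trans hTN⟩, nonempty_iff_ne_empty.2 h⟩) (not_le.2 ht.2)
    -- The upper barrier is lost after the exit time, but the bounds at `sInf S` are strict and
    -- persist for a short while. This interval contains a time in `S`, so the solution does meet
    -- the exit condition.
    have hev : ∀ᶠ t in 𝓝[≥] (sInf S), ∀ e : H.edgeSet, Z t e ∈ Ioo (lo N) (hi N) := by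
      refine eventually_all.2 fun e => ?_
      have h1 := (hZc e (sInf S) ⟨hsT, hTN.le⟩).mono_of_mem_nhdsWithin
        (mem_of_superset (Ico_mem_nhdsWithin_Ici_of_mem ⟨hsT, hTN⟩) Ico_subset_Icc_self)
      exact h1 (isOpen_Ioo.mem_nhds (hbefore _ (right_mem_Icc.2 hsT) e e.2))
    obtain ⟨u, hu, hsub⟩ := mem_nhdsGE_iff_exists_Ico_subset.1 hev
    have hub : sInf S < min u N := lt_min hu hTN
    obtain ⟨t₂, ht₂S, ht₂⟩ := (isGLB_lt_iff hT).1 hub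
    refine ⟨min u N, Z, hsT.trans_lt hub, hsol _ (min_le_right _ _) fun t ht e he => ?_, hinit,
      Or.inr ⟨t₂, ⟨ht₂S.1.1, ht₂⟩, ht₂S.2⟩⟩
    rcases lt_or_ge t (sInf S) with h | h
    · exact Ioo_subset_Icc_self (hbefore t ⟨ht.1, h.le⟩ e he)
    · exact Ioo_subset_Icc_self (hsub ⟨h, ht.2.trans_le (min_le_left _ _)⟩ ⟨e, he⟩)

end Solutions

/-! ### The flow with deletions -/

section Flow

variable {V : Type*} {γ : ℝ → ℝ} {sel : Set (Sym2 V) → Set (Sym2 V)}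
  {H : SimpleGraph V} {w₀ w₁ : Sym2 V → ℝ} {s T : ℝ} {K K' : ℝ → SimpleGraph V}
  {X Y Y' : ℝ → Sym2 V → ℝ}

/-- Makes exit times and exiting edges independent of how far beyond `T` the solution is continued.
-/
lemma isGLB_inter_Iio_iff {A : Set ℝ} {b : ℝ} (h : T < b) : IsGLB (A ∩ Iio b) T ↔ IsGLB A T := by
  constructor
  · intro hA
    refine ⟨fun t ht => ?_, fun u hu => hA.2 fun t ht => hu ht.1⟩
    rcases lt_or_ge t b with htb | htb
    · exact hA.1 ⟨ht, htb⟩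
    · exact h.le.trans htb
  · intro hA
    refine ⟨fun t ht => hA.1 ht.1, fun u hu => ?_⟩
    by_contra! hlt
    refine absurd (hA.2 (show min u b ∈ lowerBounds A from fun t ht => ?_))
      (not_le.2 (lt_min hlt h))
    rcases lt_or_ge t b with htb | htb
    · exact (min_le_left _ _).trans (hu ⟨ht, htb⟩)
    · exact (min_le_right _ _).trans htb

/-- Every real is a lower bound of the empty set, and there is no greatest real. So `IsGLB` already
says that the exit condition is met. -/
lemma nonempty_of_isGLB_real {A : Set ℝ} (h : IsGLB A T) : A.Nonempty := by
  rw [nonempty_iff_ne_empty]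
  rintro rfl
  exact absurd (h.2 (show T + 1 ∈ lowerBounds ∅ by simp)) (by simp)

lemma exitingEdges_subset {I : Set ℝ} : exitingEdges H X I T ⊆ H.edgeSet := fun _ he =>
  let ⟨_, ht⟩ := nonempty_of_isGLB_real he
  exceedingEdges_subset ht.2

lemma mem_Ico_of_isGLB {b : ℝ} {p : ℝ → Prop} (hT : IsGLB {t ∈ Ico s b | p t} T) :
    T ∈ Ico s b := by
  obtain ⟨t, ht⟩ := nonempty_of_isGLB_real hT
  exact ⟨hT.2 fun t ht => ht.1.1, (hT.1 ht).trans_lt ht.1.2⟩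

lemma sep_Ico_inter_Iio_eq {b b' : ℝ} {p q : ℝ → Prop}
    (h : ∀ t ∈ Ico s (min b b'), p t ↔ q t) :
    {t ∈ Ico s b | p t} ∩ Iio (min b b') = {t ∈ Ico s b' | q t} ∩ Iio (min b b') := by
  ext t
  constructor
  · rintro ⟨⟨ht, hp⟩, htb⟩
    exact ⟨⟨⟨ht.1, htb.trans_le (min_le_right _ _)⟩, (h t ⟨ht.1, htb⟩).1 hp⟩, htb⟩
  · rintro ⟨⟨ht, hp⟩, htb⟩
    exact ⟨⟨⟨ht.1, htb.trans_le (min_le_left _ _)⟩, (h t ⟨ht.1, htb⟩).2 hp⟩, htb⟩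

lemma edgeSet_deleteEdges_subset {S : Set (Sym2 V)} : (H.deleteEdges S).edgeSet ⊆ H.edgeSet := by
  rw [SimpleGraph.edgeSet_deleteEdges]
  exact sdiff_subset

variable [Fintype V]

/-- Solutions on all the intervals `[s, N)` fit together to a solution on `[s, ∞)`. -/
lemma exists_solution_Ici (hγ : ∀ x : ℝ, 0 < x → 0 < γ x)
    (hγlip : ∀ δ M : ℝ, 0 < δ → δ < M → ∃ C : NNReal, LipschitzOnWith C γ (Set.Icc δ M))
    (hw₀ : ∀ e ∈ H.edgeSet, 0 < w₀ e)
    (h : ∀ N, s < N → ∃ X, IsSolutionOn γ H X (Ico s N) ∧ (∀ e ∈ H.edgeSet, X s e = w₀ e) ∧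
      ∀ t ∈ Ico s N, exceedingEdges H (X t) = ∅) :
    ∃ Y, IsSolutionOn γ H Y (Ici s) ∧ (∀ e ∈ H.edgeSet, Y s e = w₀ e) ∧
      (∀ t, s ≤ t → exceedingEdges H (Y t) = ∅) := by
  have h' : ∀ N, ∃ X, s < N → IsSolutionOn γ H X (Ico s N) ∧
      (∀ e ∈ H.edgeSet, X s e = w₀ e) ∧ ∀ t ∈ Ico s N, exceedingEdges H (X t) = ∅ := by
    intro N
    by_cases hN : s < N
    · obtain ⟨X, hX⟩ := h N hN
      exact ⟨X, fun _ => hX⟩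
    · exact ⟨0, fun hc => absurd hc hN⟩
  choose X hX using h'
  have hlt : ∀ t, s ≤ t → s < t + 1 := fun t ht => by linarith
  have hmem : ∀ t, s ≤ t → t ∈ Ico s (t + 1) := fun t ht => ⟨ht, lt_add_one t⟩
  have hagree : ∀ N, s < N → ∀ t ∈ Ico s N, ∀ e ∈ H.edgeSet, X (t + 1) t e = X N t e := by
    intro N hN t ht
    have h1 := hX (t + 1) (hlt t ht.1)
    have h2 := hX N hN
    exact (h1.1.mono (Ico_subset_Ico_right (min_le_left _ N))).eqOn hγ hγlip
      (h2.1.mono (Ico_subset_Ico_right (min_le_right (t + 1) _)))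
      (fun e he => (h1.2.1 e he).symm ▸ hw₀ e he)
      (fun e he => (h1.2.1 e he).trans (h2.2.1 e he).symm)
      ⟨ht.1, lt_min (lt_add_one t) ht.2⟩
  -- At time `t` the solution with horizon `t + 1` is read off, so that `t` lies strictly before the
  -- horizon; by uniqueness the choice of horizon does not matter.
  refine ⟨fun t => X (t + 1) t, isSolutionOn_of_hasDerivWithinAt hγ fun t ht => ?_,
    (hX _ (hlt s le_rfl)).2.1, fun t ht => (hX _ (hlt t ht)).2.2 t (hmem t ht)⟩
  have ht1 := hX _ (hlt t ht)
  have hpos := ht1.1.pos hγ (fun e he => (ht1.2.1 e he).symm ▸ hw₀ e he) (hmem t ht)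
  refine ⟨hpos, fun e he => ?_⟩
  have hd := ht1.1.hasDerivWithinAt hγ (hmem t ht) hpos he
  have hn : Ico s (t + 1) ∈ 𝓝[Ici s] t := by
    rw [← Ici_inter_Iio]
    exact inter_mem_nhdsWithin _ (Iio_mem_nhds (lt_add_one t))
  refine (hd.mono_of_mem_nhdsWithin hn).congr_of_eventuallyEq ?_ rfl
  filter_upwards [hn] with τ hτ
  exact hagree (t + 1) (hlt t ht) τ hτ e he

/-- If every edge exceeded only from some time later than `T` on, the earliest of these finitely
many times would be a lower bound above `T`. -/
lemma exitingEdges_nonempty {I : Set ℝ}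
    (hT : IsGLB {t ∈ I | (exceedingEdges H (X t)).Nonempty} T) :
    (exitingEdges H X I T).Nonempty := by
  classical
  by_contra hne
  have hall : ∀ e, ∃ u > T, u ∈ lowerBounds {t ∈ I | e ∈ exceedingEdges H (X t)} := by
    intro e
    by_contra! h
    exact hne ⟨e, fun t ht => hT.1 ⟨ht.1, e, ht.2⟩, fun u hu => by
      by_contra! hlt
      exact h u hlt hu⟩
  choose u hu hlb using hall
  obtain ⟨v, hv, hTv⟩ := ((eventually_all.2 fun e => (Ioc_mem_nhdsGT (hu e) :
    ∀ᶠ v in 𝓝[>] T, v ∈ Ioc T (u e))).and (self_mem_nhdsWithin : Ioi T ∈ 𝓝[>] T)).exists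
  exact absurd (hT.2 fun t ⟨ht, e, he⟩ => (hv e).2.trans (hlb e ⟨ht, he⟩)) (not_le.2 hTv)

/-- A flow started at `s` does not see earlier times; this permits gluing it to what happened
before. -/
lemma IsFlow.congr (h : IsFlow γ sel H s w₀ K Y) (hK : ∀ t, s ≤ t → K' t = K t)
    (hY : ∀ t, s ≤ t → Y' t = Y t) : IsFlow γ sel H s w₀ K' Y' := by
  induction h with
  | noExit hsol hinit hno hK₀ =>
    refine .noExit (fun t ht => ⟨fun e he => ?_, fun x y hxy => ?_⟩)
      (fun e he => by rw [hY _ le_rfl, hinit e he]) (fun t ht => by rw [hY t ht, hno t ht])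
      (fun t ht => by rw [hK t ht, hK₀ t ht])
    · rw [hY t ht]; exact (hsol t ht).1 e he
    · obtain ⟨k, hk, hd⟩ := (hsol t ht).2 x y hxy
      refine ⟨k, (hY t ht).symm ▸ hk, ?_⟩
      rw [hY t ht]
      exact hd.congr (fun τ hτ => by rw [hY τ hτ]) (by rw [hY t ht])
  | exit X b T hX hinit hT hK₀ hYX _ ih =>
    have hsT := (mem_Ico_of_isGLB hT).1
    exact .exit X b T hX hinit hT (fun t ht => by rw [hK t ht.1, hK₀ t ht])
      (fun t ht e he => by rw [hY t ht.1, hYX t ht e he])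
      (ih (fun t ht => hK t (hsT.trans ht)) (fun t ht => hY t (hsT.trans ht)))

lemma IsFlow.pos (hγ : ∀ x : ℝ, 0 < x → 0 < γ x) (h : IsFlow γ sel H s w₀ K Y)
    (hw₀ : ∀ e ∈ H.edgeSet, 0 < w₀ e) : ∀ t, s ≤ t → ∀ e ∈ (K t).edgeSet, 0 < Y t e := by
  induction h with
  | noExit hsol hinit hno hK =>
    intro t ht e he
    rw [hK t ht] at he
    exact (hsol.mono Ico_subset_Ici_self).pos hγ (fun e he => (hinit e he).symm ▸ hw₀ e he)
      ⟨ht, lt_add_one t⟩ e he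
  | exit X b T hX hinit hT hK hYX _ ih =>
    have hTb := mem_Ico_of_isGLB hT
    have hXp : ∀ t ∈ Ico _ b, _ := fun t ht =>
      hX.pos hγ (fun e he => (hinit e he).symm ▸ hw₀ e he) ht
    intro t ht e he
    rcases lt_or_ge t T with h | h
    · rw [hK t ⟨ht, h⟩] at he
      rw [hYX t ⟨ht, h⟩ e he]
      exact hXp t ⟨ht, h.trans hTb.2⟩ e he
    · exact ih (fun e he => hXp T hTb e (edgeSet_deleteEdges_subset he)) t h e he

/-- Induction over the first flow, comparing its initial stage with that of the second. Solutions
agree on their common interval, so either both exit or neither does, and the exit data coincide. -/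
lemma IsFlow.unique (hγ : ∀ x : ℝ, 0 < x → 0 < γ x)
    (hγlip : ∀ δ M : ℝ, 0 < δ → δ < M → ∃ C : NNReal, LipschitzOnWith C γ (Set.Icc δ M))
    (h : IsFlow γ sel H s w₀ K Y) (hw₀ : ∀ e ∈ H.edgeSet, 0 < w₀ e)
    (h' : IsFlow γ sel H s w₁ K' Y') (hw : ∀ e ∈ H.edgeSet, w₀ e = w₁ e) :
    ∀ t, s ≤ t → K' t = K t ∧ ∀ e ∈ (K t).edgeSet, Y' t e = Y t e := by
  induction h generalizing w₁ with
  | @noExit H s w₀ K Y hsol hinit hno hK =>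
    cases h' with
    | noExit hsol' hinit' hno' hK' =>
      intro t ht
      refine ⟨(hK' t ht).trans (hK t ht).symm, fun e he => ?_⟩
      rw [hK t ht] at he
      exact ((hsol.mono Ico_subset_Ici_self).eqOn hγ hγlip (hsol'.mono Ico_subset_Ici_self)
        (fun e he => (hinit e he).symm ▸ hw₀ e he)
        (fun e he => by rw [hinit e he, hinit' e he, hw e he]) ⟨ht, lt_add_one t⟩ e he).symm
    | exit X' b' T' hX' hinit' hT' hK' hYX' hrest' =>
      obtain ⟨t, ht, hex⟩ := nonempty_of_isGLB_real hT'
      have := (hsol.mono Ico_subset_Ici_self).eqOn hγ hγlip hX'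
        (fun e he => (hinit e he).symm ▸ hw₀ e he)
        (fun e he => by rw [hinit e he, hinit' e he, hw e he]) ht
      rw [← exceedingEdges_congr this, hno t ht.1] at hex
      exact absurd hex not_nonempty_empty
  | @exit H s w₀ K Y X b T hX hinit hT hK hYX hrest ih =>
    have hXs : ∀ e ∈ H.edgeSet, 0 < X s e := fun e he => (hinit e he).symm ▸ hw₀ e he
    cases h' with
    | noExit hsol' hinit' hno' hK' =>
      obtain ⟨t, ht, hex⟩ := nonempty_of_isGLB_real hT
      have := hX.eqOn hγ hγlip (hsol'.mono Ico_subset_Ici_self) hXs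
        (fun e he => by rw [hinit e he, hinit' e he, hw e he]) ht
      rw [exceedingEdges_congr this, hno' t ht.1] at hex
      exact absurd hex not_nonempty_empty
    | exit X' b' T' hX' hinit' hT' hK' hYX' hrest' =>
      have hagree : ∀ t ∈ Ico s (min b b'), ∀ e ∈ H.edgeSet, X t e = X' t e := fun t ht =>
        (hX.mono (Ico_subset_Ico_right (min_le_left _ _))).eqOn hγ hγlip
          (hX'.mono (Ico_subset_Ico_right (min_le_right _ _))) hXs
          (fun e he => by rw [hinit e he, hinit' e he, hw e he]) ht
      have hexc : ∀ t ∈ Ico s (min b b'), exceedingEdges H (X t) = exceedingEdges H (X' t) :=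
        fun t ht => exceedingEdges_congr (hagree t ht)
      have hTb := mem_Ico_of_isGLB hT
      have hTb' := mem_Ico_of_isGLB hT'
      have hsets := sep_Ico_inter_Iio_eq
        (p := fun t => (exceedingEdges H (X t)).Nonempty)
        (q := fun t => (exceedingEdges H (X' t)).Nonempty) fun t ht => by rw [hexc t ht]
      -- The smaller of the two exit times lies inside the common interval, where both solutions
      -- meet the exit condition at the same times.
      have hTT : T = T' := by
        rcases le_total T T' with hle | hle
        · have hlt : T < min b b' := lt_min hTb.2 (hle.trans_lt hTb'.2)
          rw [← isGLB_inter_Iio_iff hlt, hsets, isGLB_inter_Iio_iff hlt] at hT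
          exact hT.unique hT'
        · have hlt : T' < min b b' := lt_min (hle.trans_lt hTb.2) hTb'.2
          rw [← isGLB_inter_Iio_iff hlt, ← hsets, isGLB_inter_Iio_iff hlt] at hT'
          exact hT.unique hT'
      subst hTT
      have hlt : T < min b b' := lt_min hTb.2 hTb'.2
      have hexit : exitingEdges H X (Ico s b) T = exitingEdges H X' (Ico s b') T := by
        ext e
        simp only [exitingEdges, mem_ofPred_eq]
        rw [← isGLB_inter_Iio_iff hlt, sep_Ico_inter_Iio_eq
          (q := fun t => e ∈ exceedingEdges H (X' t)) fun t ht => by rw [hexc t ht],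
          isGLB_inter_Iio_iff hlt]
      intro t ht
      rcases lt_or_ge t T with htT | htT
      · refine ⟨(hK' t ⟨ht, htT⟩).trans (hK t ⟨ht, htT⟩).symm, fun e he => ?_⟩
        rw [hK t ⟨ht, htT⟩] at he
        rw [hYX t ⟨ht, htT⟩ e he, hYX' t ⟨ht, htT⟩ e he,
          hagree t ⟨ht, htT.trans hlt⟩ e he]
      · rw [← hexit] at hrest'
        exact ih (fun e he => hX.pos hγ hXs hTb e (edgeSet_deleteEdges_subset he)) hrest'
          (fun e he => hagree T ⟨hTb.1, hlt⟩ e (edgeSet_deleteEdges_subset he)) t htT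

/-- Strong induction on the number of edges: the selected edges belong to the current graph, so each
restart has strictly fewer. -/
lemma exists_isFlow (hγ : ∀ x : ℝ, 0 < x → 0 < γ x)
    (hγlip : ∀ δ M : ℝ, 0 < δ → δ < M → ∃ C : NNReal, LipschitzOnWith C γ (Set.Icc δ M))
    (hsel : IsSelectionRule sel) (hw₀ : ∀ e ∈ H.edgeSet, 0 < w₀ e) (s : ℝ) :
    ∃ K Y, IsFlow γ sel H s w₀ K Y := by
  classical
  induction hn : H.edgeSet.ncard using Nat.strong_induction_on generalizing H w₀ s with
  | _ n ih =>
  by_cases hex : ∃ (b : ℝ) (X : ℝ → Sym2 V → ℝ), IsSolutionOn γ H X (Ico s b) ∧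
      (∀ e ∈ H.edgeSet, X s e = w₀ e) ∧ ∃ t ∈ Ico s b, (exceedingEdges H (X t)).Nonempty
  · obtain ⟨b, X, hX, hinit, t₁, ht₁, hne⟩ := hex
    obtain ⟨T, hT⟩ : ∃ T, IsGLB {t ∈ Ico s b | (exceedingEdges H (X t)).Nonempty} T :=
      ⟨_, isGLB_csInf ⟨t₁, ht₁, hne⟩ ⟨s, fun t ht => ht.1.1⟩⟩
    have hTb := mem_Ico_of_isGLB hT
    set S := exitingEdges H X (Ico s b) T
    obtain ⟨⟨e, he⟩, hsub⟩ := hsel S (exitingEdges_nonempty hT)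
    have hcard : (H.deleteEdges (sel S)).edgeSet.ncard < n := by
      rw [← hn]
      refine ncard_lt_ncard ⟨edgeSet_deleteEdges_subset, fun h => ?_⟩ (toFinite _)
      have := h (exitingEdges_subset (hsub he))
      rw [SimpleGraph.edgeSet_deleteEdges] at this
      exact this.2 he
    obtain ⟨K, Y, hKY⟩ := ih _ hcard (w₀ := X T)
      (fun e he => hX.pos hγ (fun e he => (hinit e he).symm ▸ hw₀ e he) hTb e
        (edgeSet_deleteEdges_subset he)) T rfl
    refine ⟨fun t => if t < T then H else K t, fun t => if t < T then X t else Y t,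
      .exit X b T hX hinit hT (fun t ht => if_pos ht.2) (fun t ht e _ => by rw [if_pos ht.2])
        (hKY.congr (fun t ht => if_neg (not_lt.2 ht)) (fun t ht => if_neg (not_lt.2 ht)))⟩
  · obtain ⟨Y, hY, hinit, hno⟩ := exists_solution_Ici (s := s) hγ hγlip hw₀ fun N hN => by
      obtain ⟨b, X, -, hX, hinit, ⟨rfl, hno⟩ | h⟩ := exists_solution hγ hγlip hw₀ hN
      · exact ⟨X, hX, hinit, hno⟩
      · exact absurd ⟨b, X, hX, hinit, h⟩ hex
    exact ⟨fun _ => H, Y, .noExit hY hinit hno fun _ _ => rfl⟩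

end Flow

end RicciFlow

/-! ### The main theorem -/

theorem mainTheorem2 {V : Type*} [Fintype V] (G : SimpleGraph V) (hG : G.Connected)
    (γ : ℝ → ℝ) (hγpos : ∀ x : ℝ, 0 < x → 0 < γ x)
    (hγlip : ∀ δ M : ℝ, 0 < δ → δ < M → ∃ C : NNReal, LipschitzOnWith C γ (Set.Icc δ M))
    (w₀ : Sym2 V → ℝ) (hw₀ : ∀ e ∈ G.edgeSet, 0 < w₀ e) :
    -- the flow in which edges meeting the exit condition are deleted
    (∀ sel : Set (Sym2 V) → Set (Sym2 V), RicciFlow.IsSelectionRule sel →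
      ∃ (K : ℝ → SimpleGraph V) (X : ℝ → Sym2 V → ℝ),
        RicciFlow.IsFlow γ sel G 0 w₀ K X ∧
        (∀ t, 0 ≤ t → ∀ e ∈ (K t).edgeSet, 0 < X t e) ∧
        ∀ (K' : ℝ → SimpleGraph V) (X' : ℝ → Sym2 V → ℝ),
          RicciFlow.IsFlow γ sel G 0 w₀ K' X' →
          ∀ t, 0 ≤ t → K' t = K t ∧ ∀ e ∈ (K t).edgeSet, X' t e = X t e) ∧
    -- the system on the fixed graph `G`, when the exit condition is never met
    ((∀ (b : ℝ) (X : ℝ → Sym2 V → ℝ), 0 < b →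
        RicciFlow.IsSolutionOn γ G X (Set.Ico 0 b) → (∀ e ∈ G.edgeSet, X 0 e = w₀ e) →
        ∀ t ∈ Set.Ico 0 b, RicciFlow.exceedingEdges G (X t) = ∅) →
      ∃ X : ℝ → Sym2 V → ℝ,
        RicciFlow.IsSolutionOn γ G X (Set.Ici 0) ∧
        (∀ e ∈ G.edgeSet, X 0 e = w₀ e) ∧
        (∀ t, 0 ≤ t → ∀ e ∈ G.edgeSet, 0 < X t e) ∧
        ∀ X' : ℝ → Sym2 V → ℝ,
          RicciFlow.IsSolutionOn γ G X' (Set.Ici 0) → (∀ e ∈ G.edgeSet, X' 0 e = w₀ e) →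
          ∀ t, 0 ≤ t → ∀ e ∈ G.edgeSet, X' t e = X t e) := by
  constructor
  · intro sel hsel
    obtain ⟨K, X, h⟩ := RicciFlow.exists_isFlow hγpos hγlip hsel hw₀ 0
    exact ⟨K, X, h, h.pos hγpos hw₀, fun K' X' h' =>
      h.unique hγpos hγlip hw₀ h' fun _ _ => rfl⟩
  · intro hno
    -- For every horizon `N` the hypothesis rules out the exit alternative of `exists_solution`.
    obtain ⟨X, hX, hinit, -⟩ := RicciFlow.exists_solution_Ici hγpos hγlip hw₀ (s := 0)
      fun N hN => by
        obtain ⟨b, X, hb, hX, hinit, ⟨rfl, h⟩ | ⟨t, ht, h⟩⟩ :=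
          RicciFlow.exists_solution hγpos hγlip hw₀ hN
        · exact ⟨X, hX, hinit, h⟩
        · rw [hno b X hb hX hinit t ht] at h
          exact absurd h Set.not_nonempty_empty
    have hX0 : ∀ e ∈ G.edgeSet, 0 < X 0 e := fun e he => (hinit e he).symm ▸ hw₀ e he
    refine ⟨X, hX, hinit, fun t ht => (hX.mono Set.Ico_subset_Ici_self).pos hγpos hX0
      ⟨ht, lt_add_one t⟩, fun X' hX' hinit' t ht e he => ?_⟩
    exact ((hX.mono Set.Ico_subset_Ici_self).eqOn hγpos hγlip (hX'.mono Set.Ico_subset_Ici_self)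
      hX0 (fun e he => (hinit e he).trans (hinit' e he).symm) ⟨ht, lt_add_one t⟩ e he).symm
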